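/- Let $m\ge 1$ and $n>2m$ be integers, let $\sigma>-2m$ be real, and let $p\ge \dfrac{n+2m+2\sigma}{n-2m}$. Consider the equation $$(-\Delta)^m u=|x|^\sigma u^p\quad\text{in }\mathbb R^n .$$ A \emph{classical solution} is a function $u:\mathbb R^n\to[0,\infty)$, not identically zero, such that: if $\sigma\ge 0$, then $u\in C^{2m}(\mathbb R^n)$ and the equation holds at every point of $\mathbb R^n$; if $\sigma<0$, then $u\in C(\mathbb R^n)\cap C^{2m}(\mathbb R^n\setminus\{0\})$ and the equation holds at every point of $\mathbb R^n\setminus\{0\}$. Then every classical solution $u$ satisfies $$(-\Delta)^{m-i}u>0\quad\text{in }\mathbb R^n\setminus\{0\}\qquad\text{for all } 1\le i\le m-1,$$ and moreover $u>0$ in $\mathbb R^n$. -/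

import Mathlib

/-- The operator `(-Δ)^k` acting on functions `ℝⁿ → ℝ`: the `k`-fold iterate of `v ↦ -Δ v`,
where `Δ` is the classical (pointwise) Laplacian. -/
noncomputable def negLaplacianPow {n : ℕ} (k : ℕ) (u : EuclideanSpace ℝ (Fin n) → ℝ) :
    EuclideanSpace ℝ (Fin n) → ℝ :=
  (fun v : EuclideanSpace ℝ (Fin n) → ℝ => -Laplacian.laplacian v)^[k] u

/-- A (non-negative, non-trivial) classical solution of `(-Δ)^m u = |x|^σ u^p` in `ℝⁿ`.
For `σ ≥ 0` the function is `C^{2m}` and the equation holds everywhere; for `σ < 0` it is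
continuous, `C^{2m}` off the origin, and the equation holds off the origin. -/
structure IsClassicalSolution {n : ℕ} (m : ℕ) (σ p : ℝ)
    (u : EuclideanSpace ℝ (Fin n) → ℝ) : Prop where
  nonneg : ∀ x, 0 ≤ u x
  nontrivial : ∃ x, u x ≠ 0
  regular_of_nonneg : 0 ≤ σ → ContDiff ℝ ((2 * m : ℕ) : WithTop ℕ∞) u
  equation_of_nonneg : 0 ≤ σ → ∀ x, negLaplacianPow m u x = ‖x‖ ^ σ * u x ^ p
  continuous_of_neg : σ < 0 → Continuous u
  regular_of_neg : σ < 0 → ContDiffOn ℝ ((2 * m : ℕ) : WithTop ℕ∞) u {0}ᶜ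
  equation_of_neg : σ < 0 → ∀ x, x ≠ 0 → negLaplacianPow m u x = ‖x‖ ^ σ * u x ^ p

/-! The hypothesis on `p` enters only through two consequences: `p > 1` and `σ < n (p - 1)`. The
origin is removable: as `u` is continuous and `2m < n`, cutting a test function off at scale `δ`
costs `O(δ^(n-2m))`, so the equation holds in the sense of distributions
(`integral_mul_negLaplacianPow_eq`). Testing with a high power of a cutoff and absorbing by Young's
inequality bounds `∫ u` over the unit ball by a constant common to all solutions
(`exists_integral_unitBall_le`). Applied to the rescaled solutions `R^α u(R x)`, `α = (2m+σ)/(p-1) >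
0`, this makes the averages of `u` over large balls tend to zero.

Suppose `v` is smooth, `(-Δ)^m v ≥ 0`, and the averages of `|v|` vanish at infinity. If `(-Δ)^(k+1)
v ≥ 0`, then `w = (-Δ)^k v` is superharmonic, so `w(a)` dominates its weighted averages over balls
around `a`; integration by parts shows that these tend to zero, hence `w ≥ 0`. Descending induction
on `k` yields every sign (`negLaplacianPow_nonneg_of_averages_tendsto`). This is applied to
mollifications of `u`, which are smooth across the origin, and the sign passes to `u` wherever
`(-Δ)^k u` is continuous.

For strictness, `(-Δ)^k u` cannot vanish identically off the origin, since the equation would force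
`u = 0`. It is therefore positive on some ball, and for `k < m` the mean value inequality on a
larger ball carries a positive lower bound to any prescribed point (`negLaplacianPow_pos`). -/

open MeasureTheory Set Filter Topology Metric
open scoped ContDiff Laplacian Convolution

/-! ### Iterated Laplacians: regularity, scaling, integration by parts -/

section Calculus

variable {n : ℕ}

local notation "𝔼" => EuclideanSpace ℝ (Fin n)

/-- The `i`-th standard basis vector. -/
noncomputable abbrev stdVec (i : Fin n) : 𝔼 := EuclideanSpace.basisFun (Fin n) ℝ i

theorem laplacian_eq_sum_fderiv_fderiv (f : 𝔼 → ℝ) (x : 𝔼) :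
    Laplacian.laplacian f x = ∑ i, fderiv ℝ (fderiv ℝ f) x (stdVec i) (stdVec i) := by
  rw [InnerProductSpace.laplacian_eq_iteratedFDeriv_orthonormalBasis f
    (EuclideanSpace.basisFun (Fin n) ℝ)]
  simp [iteratedFDeriv_two_apply, stdVec]

theorem ContDiffAt.laplacian_eq_sum {f : 𝔼 → ℝ} {x : 𝔼} (hf : ContDiffAt ℝ 2 f x) :
    Laplacian.laplacian f x =
      ∑ i, fderiv ℝ (fun y => fderiv ℝ f y (stdVec i)) x (stdVec i) := by
  rw [laplacian_eq_sum_fderiv_fderiv]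
  refine Finset.sum_congr rfl fun i _ => ?_
  have h : DifferentiableAt ℝ (fderiv ℝ f) x :=
    (hf.fderiv_right (m := 1) (by norm_num)).differentiableAt (by norm_num)
  rw [fderiv_clm_apply h (differentiableAt_const _)]
  simp

theorem contDiffOn_fderiv_apply {Ω : Set 𝔼} (hΩ : IsOpen Ω) {f : 𝔼 → ℝ} {k N : WithTop ℕ∞}
    (hf : ContDiffOn ℝ N f Ω) (hk : k + 1 ≤ N) (v : 𝔼) :
    ContDiffOn ℝ k (fun y => fderiv ℝ f y v) Ω :=
  (hf.fderiv_of_isOpen hΩ hk).clm_apply contDiffOn_const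

theorem ContDiffOn.laplacian {Ω : Set 𝔼} (hΩ : IsOpen Ω) {f : 𝔼 → ℝ} {k N : WithTop ℕ∞}
    (hf : ContDiffOn ℝ N f Ω) (hk : k + 2 ≤ N) :
    ContDiffOn ℝ k (Laplacian.laplacian f) Ω := by
  have hk' : k + 1 + 1 ≤ N := by rw [add_assoc, one_add_one_eq_two]; exact hk
  have h2 : ContDiffOn ℝ 2 f Ω := hf.of_le (le_trans le_add_self hk)
  have key : ContDiffOn ℝ k
      (fun x => ∑ i : Fin n, fderiv ℝ (fun y => fderiv ℝ f y (stdVec i)) x (stdVec i)) Ω :=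
    ContDiffOn.sum fun i _ => contDiffOn_fderiv_apply hΩ
      (contDiffOn_fderiv_apply hΩ hf hk' (stdVec i)) le_rfl (stdVec i)
  exact key.congr fun x hx => (h2.contDiffAt (hΩ.mem_nhds hx)).laplacian_eq_sum

theorem negLaplacianPow_succ (k : ℕ) (u : 𝔼 → ℝ) :
    negLaplacianPow (k + 1) u = -Laplacian.laplacian (negLaplacianPow k u) := by
  simp only [negLaplacianPow, Function.iterate_succ', Function.comp]

@[simp] theorem negLaplacianPow_zero (u : 𝔼 → ℝ) : negLaplacianPow 0 u = u := rfl

theorem negLaplacianPow_succ' (k : ℕ) (u : 𝔼 → ℝ) :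
    negLaplacianPow (k + 1) u = negLaplacianPow k (-Laplacian.laplacian u) := by
  simp only [negLaplacianPow, Function.iterate_succ, Function.comp]

theorem ContDiffOn.negLaplacianPow {Ω : Set 𝔼} (hΩ : IsOpen Ω) {f : 𝔼 → ℝ} {N : WithTop ℕ∞}
    (k : ℕ) : ∀ {j : WithTop ℕ∞}, ContDiffOn ℝ N f Ω → j + (2 * k : ℕ) ≤ N →
    ContDiffOn ℝ j (_root_.negLaplacianPow k f) Ω := by
  induction k with
  | zero => intro j hf hj; exact hf.of_le (by simpa using hj)
  | succ k ih =>
    intro j hf hj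
    rw [negLaplacianPow_succ]
    refine (ContDiffOn.laplacian hΩ (ih (j := j + 2) hf ?_) le_rfl).neg
    refine le_trans (le_of_eq ?_) hj
    rw [add_assoc]; congr 1; push_cast; ring

theorem ContDiff.negLaplacianPow {f : 𝔼 → ℝ} (hf : ContDiff ℝ ∞ f) (k : ℕ) :
    ContDiff ℝ ∞ (_root_.negLaplacianPow k f) :=
  contDiffOn_univ.1 (ContDiffOn.negLaplacianPow isOpen_univ k hf.contDiffOn le_rfl)

theorem negLaplacianPow_congr {f g : 𝔼 → ℝ} {x : 𝔼} (h : f =ᶠ[𝓝 x] g) (k : ℕ) :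
    negLaplacianPow k f =ᶠ[𝓝 x] negLaplacianPow k g := by
  induction k with
  | zero => exact h
  | succ k ih =>
    rw [negLaplacianPow_succ, negLaplacianPow_succ]
    exact (InnerProductSpace.laplacian_congr_nhds ih).neg

theorem negLaplacianPow_zero_fun (k : ℕ) : negLaplacianPow k (0 : 𝔼 → ℝ) = 0 := by
  induction k with
  | zero => rfl
  | succ k ih =>
    rw [negLaplacianPow_succ, ih]
    ext x
    simp [laplacian_eq_sum_fderiv_fderiv]

theorem tsupport_negLaplacianPow_subset (f : 𝔼 → ℝ) (k : ℕ) :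
    tsupport (negLaplacianPow k f) ⊆ tsupport f := by
  refine closure_minimal (fun x hx => ?_) (isClosed_tsupport f)
  by_contra h
  have h0 := (negLaplacianPow_congr (notMem_tsupport_iff_eventuallyEq.1 h) k).eq_of_nhds
  rw [negLaplacianPow_zero_fun] at h0
  exact hx h0

theorem HasCompactSupport.negLaplacianPow {f : 𝔼 → ℝ} (hf : HasCompactSupport f) (k : ℕ) :
    HasCompactSupport (_root_.negLaplacianPow k f) :=
  hf.of_isClosed_subset (isClosed_tsupport _) (tsupport_negLaplacianPow_subset f k)

theorem fderiv_const_smul_fun {F : Type*} [NormedAddCommGroup F] [NormedSpace ℝ F]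
    (g : 𝔼 → F) (c : ℝ) : fderiv ℝ (fun y => c • g y) = fun y => c • fderiv ℝ g y :=
  fderiv_const_smul_field (𝕜 := ℝ) (f := g) c

theorem laplacian_comp_affine (f : 𝔼 → ℝ) (a : 𝔼) (r : ℝ) (x : 𝔼) :
    Laplacian.laplacian (fun y => f (a + r • y)) x =
      r ^ 2 * Laplacian.laplacian f (a + r • x) := by
  have h1 : ∀ (F : Type) [NormedAddCommGroup F] [NormedSpace ℝ F] (g : 𝔼 → F),
      fderiv ℝ (fun y => g (a + r • y)) = fun y => r • fderiv ℝ g (a + r • y) := by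
    intro F _ _ g
    ext1 y
    rw [fderiv_comp_smul (f := fun z => g (a + z)) r, fderiv_comp_add_left]
  have h2 : fderiv ℝ (fun y => r • fderiv ℝ f (a + r • y)) =
      fun y => r • fderiv ℝ (fun z => fderiv ℝ f (a + r • z)) y :=
    fderiv_const_smul_fun (fun y => fderiv ℝ f (a + r • y)) r
  rw [laplacian_eq_sum_fderiv_fderiv, laplacian_eq_sum_fderiv_fderiv, h1, h2, h1,
    Finset.mul_sum]
  refine Finset.sum_congr rfl fun i _ => ?_
  simp
  ring

theorem laplacian_const_mul (f : 𝔼 → ℝ) (c : ℝ) :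
    Laplacian.laplacian (fun y => c * f y) = fun y => c * Laplacian.laplacian f y := by
  ext x
  have h2 : fderiv ℝ (fun y => c • fderiv ℝ f y) = fun y => c • fderiv ℝ (fderiv ℝ f) y :=
    fderiv_const_smul_fun (fderiv ℝ f) c
  rw [laplacian_eq_sum_fderiv_fderiv, laplacian_eq_sum_fderiv_fderiv,
    show (fun y => c * f y) = fun y => c • f y from rfl, fderiv_const_smul_fun, h2,
    Finset.mul_sum]
  simp

theorem negLaplacianPow_const_mul (f : 𝔼 → ℝ) (c : ℝ) (k : ℕ) :
    negLaplacianPow k (fun y => c * f y) = fun y => c * negLaplacianPow k f y := by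
  induction k with
  | zero => rfl
  | succ k ih =>
    rw [negLaplacianPow_succ, negLaplacianPow_succ, ih, laplacian_const_mul]
    ext x
    simp

theorem negLaplacianPow_comp_affine (f : 𝔼 → ℝ) (a : 𝔼) (r : ℝ) (k : ℕ) :
    negLaplacianPow k (fun y => f (a + r • y)) =
      fun y => r ^ (2 * k) * negLaplacianPow k f (a + r • y) := by
  induction k with
  | zero => simp
  | succ k ih =>
    rw [negLaplacianPow_succ, ih, laplacian_const_mul, negLaplacianPow_succ]
    ext x
    simp only [Pi.neg_apply, laplacian_comp_affine]
    ring

/-- A product of a function continuous on an open set with a continuous function compactly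
supported inside this set is continuous. -/
theorem continuous_mul_of_tsupport_subset {Ω : Set 𝔼} (hΩ : IsOpen Ω) {v φ : 𝔼 → ℝ}
    (hv : ContinuousOn v Ω) (hφ : Continuous φ) (hs : tsupport φ ⊆ Ω) :
    Continuous fun x => v x * φ x := by
  refine continuous_iff_continuousAt.2 fun x => ?_
  by_cases hx : x ∈ tsupport φ
  · exact (hv.continuousAt (hΩ.mem_nhds (hs hx))).mul hφ.continuousAt
  · have : (fun x => v x * φ x) =ᶠ[𝓝 x] fun _ => 0 := by
      filter_upwards [notMem_tsupport_iff_eventuallyEq.1 hx] with y hy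
      simp [hy]
    exact (continuousAt_const (y := (0 : ℝ))).congr this.symm

theorem integrable_mul_of_tsupport_subset {Ω : Set 𝔼} (hΩ : IsOpen Ω) {v φ : 𝔼 → ℝ}
    (hv : ContinuousOn v Ω) (hφ : Continuous φ) (hc : HasCompactSupport φ)
    (hs : tsupport φ ⊆ Ω) : Integrable fun x => v x * φ x :=
  (continuous_mul_of_tsupport_subset hΩ hv hφ hs).integrable_of_hasCompactSupport hc.mul_left

theorem integral_mul_fderiv_of_tsupport_subset {Ω : Set 𝔼} (hΩ : IsOpen Ω) {v φ : 𝔼 → ℝ}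
    (hv : ContDiffOn ℝ 1 v Ω) (hφ : ContDiff ℝ 1 φ) (hc : HasCompactSupport φ)
    (hs : tsupport φ ⊆ Ω) (e : 𝔼) :
    ∫ x, v x * fderiv ℝ φ x e = -∫ x, fderiv ℝ v x e * φ x := by
  have hc' : HasCompactSupport fun x => fderiv ℝ φ x e := hc.fderiv_apply (𝕜 := ℝ) e
  have hs' : tsupport (fun x => fderiv ℝ φ x e) ⊆ Ω :=
    (tsupport_fderiv_apply_subset ℝ e).trans hs
  refine integral_mul_fderiv_eq_neg_fderiv_mul_of_integrable ?_ ?_ ?_ ?_ ?_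
  · exact integrable_mul_of_tsupport_subset hΩ
      (contDiffOn_fderiv_apply hΩ hv (k := 0) (by simp) e).continuousOn hφ.continuous hc hs
  · exact integrable_mul_of_tsupport_subset hΩ hv.continuousOn
      ((hφ.continuous_fderiv (by norm_num)).clm_apply continuous_const) hc' hs'
  · exact integrable_mul_of_tsupport_subset hΩ hv.continuousOn hφ.continuous hc hs
  · exact fun x hx => (hv.contDiffAt (hΩ.mem_nhds (hs hx))).differentiableAt (by norm_num)
  · exact fun x _ => hφ.contDiffAt.differentiableAt (by norm_num)

/-- Only one derivative is moved, so a `C¹` test function suffices; the mean value inequality needs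
this for `radialPotential`. -/
theorem integral_laplacian_mul_eq_neg_sum {Ω : Set 𝔼} (hΩ : IsOpen Ω) {v φ : 𝔼 → ℝ}
    (hv : ContDiffOn ℝ 2 v Ω) (hφ : ContDiff ℝ 1 φ) (hc : HasCompactSupport φ)
    (hs : tsupport φ ⊆ Ω) :
    ∫ x, Laplacian.laplacian v x * φ x =
      -∑ i, ∫ x, fderiv ℝ v x (stdVec i) * fderiv ℝ φ x (stdVec i) := by
  have h1 : ∀ i : Fin n, ContDiffOn ℝ 1 (fun y => fderiv ℝ v y (stdVec i)) Ω := fun i =>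
    contDiffOn_fderiv_apply hΩ hv (by norm_num) _
  have h2 : ∀ x, Laplacian.laplacian v x * φ x =
      ∑ i, fderiv ℝ (fun y => fderiv ℝ v y (stdVec i)) x (stdVec i) * φ x := by
    intro x
    by_cases hx : x ∈ tsupport φ
    · rw [(hv.contDiffAt (hΩ.mem_nhds (hs hx))).laplacian_eq_sum, Finset.sum_mul]
    · simp [image_eq_zero_of_notMem_tsupport hx]
  simp_rw [h2]
  rw [integral_finsetSum, ← Finset.sum_neg_distrib]
  · refine Finset.sum_congr rfl fun i _ => ?_
    rw [integral_mul_fderiv_of_tsupport_subset hΩ (h1 i) hφ hc hs, neg_neg]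
  · exact fun i _ => integrable_mul_of_tsupport_subset hΩ
      (contDiffOn_fderiv_apply hΩ (h1 i) (k := 0) (by simp) _).continuousOn hφ.continuous hc hs

theorem integral_laplacian_mul {Ω : Set 𝔼} (hΩ : IsOpen Ω) {v φ : 𝔼 → ℝ}
    (hv : ContDiffOn ℝ 2 v Ω) (hφ : ContDiff ℝ 2 φ) (hc : HasCompactSupport φ)
    (hs : tsupport φ ⊆ Ω) :
    ∫ x, Laplacian.laplacian v x * φ x = ∫ x, v x * Laplacian.laplacian φ x := by
  have h1 : ∀ i : Fin n, ContDiff ℝ 1 (fun y => fderiv ℝ φ y (stdVec i)) := fun i =>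
    (hφ.fderiv_right (m := 1) (by norm_num)).clm_apply contDiff_const
  have h1c : ∀ i : Fin n, HasCompactSupport (fun y => fderiv ℝ φ y (stdVec i)) := fun i =>
    hc.fderiv_apply (𝕜 := ℝ) _
  have h1s : ∀ i : Fin n, tsupport (fun y => fderiv ℝ φ y (stdVec i)) ⊆ Ω := fun i =>
    (tsupport_fderiv_apply_subset ℝ _).trans hs
  rw [integral_laplacian_mul_eq_neg_sum hΩ hv (hφ.of_le (by norm_num)) hc hs,
    ← Finset.sum_neg_distrib]
  simp_rw [fun x => (hφ.contDiffAt (x := x)).laplacian_eq_sum, Finset.mul_sum]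
  rw [integral_finsetSum]
  · refine Finset.sum_congr rfl fun i _ => ?_
    rw [integral_mul_fderiv_of_tsupport_subset hΩ (hv.of_le (by norm_num)) (h1 i) (h1c i) (h1s i)]
  · exact fun i _ => integrable_mul_of_tsupport_subset hΩ hv.continuousOn
      (((h1 i).continuous_fderiv (by norm_num)).clm_apply continuous_const)
      ((h1c i).fderiv_apply (𝕜 := ℝ) _) ((tsupport_fderiv_apply_subset ℝ _).trans (h1s i))

theorem integral_negLaplacianPow_mul {Ω : Set 𝔼} (hΩ : IsOpen Ω) {v φ : 𝔼 → ℝ} (k : ℕ)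
    (hv : ContDiffOn ℝ (2 * k : ℕ) v Ω) (hφ : ContDiff ℝ ∞ φ) (hc : HasCompactSupport φ)
    (hs : tsupport φ ⊆ Ω) :
    ∫ x, negLaplacianPow k v x * φ x = ∫ x, v x * negLaplacianPow k φ x := by
  induction k generalizing φ with
  | zero => rfl
  | succ k ih =>
    have h := integral_laplacian_mul hΩ
      (ContDiffOn.negLaplacianPow hΩ (j := 2) k hv (by push_cast; rw [add_comm, mul_add, mul_one]))
      (hφ.of_le (by norm_cast)) hc hs
    rw [negLaplacianPow_succ, negLaplacianPow_succ']
    simp only [Pi.neg_apply, neg_mul, integral_neg]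
    rw [h, ← integral_neg]
    have h2 := ih (φ := -Laplacian.laplacian φ)
      (hv.of_le (by exact_mod_cast (by omega : 2 * k ≤ 2 * (k + 1))))
      (hφ.negLaplacianPow 1) (hc.negLaplacianPow 1)
      ((tsupport_negLaplacianPow_subset φ 1).trans hs)
    rw [← h2]
    simp

end Calculus

/-! ### Removability of the origin and the distributional equation -/

section WeakFormulation

variable {n : ℕ}

local notation "𝔼" => EuclideanSpace ℝ (Fin n)

theorem negLaplacianPow_sub {f g : 𝔼 → ℝ} (hf : ContDiff ℝ ∞ f) (hg : ContDiff ℝ ∞ g) (k : ℕ) :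
    negLaplacianPow k (fun x => f x - g x) =
      fun x => negLaplacianPow k f x - negLaplacianPow k g x := by
  induction k with
  | zero => rfl
  | succ k ih =>
    ext x
    simp only [negLaplacianPow_succ, ih, Pi.neg_apply]
    have h := ((hf.negLaplacianPow k).contDiffAt (x := x)).of_le
      (m := 2) (by norm_cast)
    have h' := ((hg.negLaplacianPow k).contDiffAt (x := x)).of_le
      (m := 2) (by norm_cast)
    have := h.laplacian_sub h'
    rw [show (fun x => negLaplacianPow k f x - negLaplacianPow k g x) =
      negLaplacianPow k f - negLaplacianPow k g from rfl, this]
    ring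

/-- Joint smoothness gives, by compactness, bounds on the iterated Laplacians that are uniform in
the parameter. -/
theorem contDiff_negLaplacianPow_param {Ψ : ℝ → 𝔼 → ℝ}
    (hΨ : ContDiff ℝ ∞ fun q : ℝ × 𝔼 => Ψ q.1 q.2) (k : ℕ) :
    ContDiff ℝ ∞ fun q : ℝ × 𝔼 => negLaplacianPow k (Ψ q.1) q.2 := by
  have step : ∀ {Φ : ℝ → 𝔼 → ℝ} (_ : ContDiff ℝ ∞ fun q : ℝ × 𝔼 => Φ q.1 q.2) (v : 𝔼),
      ContDiff ℝ ∞ fun q : ℝ × 𝔼 => fderiv ℝ (Φ q.1) q.2 v := by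
    intro Φ hΦ v
    refine ContDiff.clm_apply ?_ contDiff_const
    refine ContDiff.fderiv (𝕜 := ℝ) (f := fun (q : ℝ × 𝔼) y => Φ q.1 y) (n := ∞) (m := ∞) ?_
      contDiff_snd (by simp)
    exact hΦ.comp ((contDiff_fst.comp contDiff_fst).prodMk contDiff_snd)
  induction k with
  | zero => exact hΨ
  | succ k ih =>
    have h : ∀ q : ℝ × 𝔼, negLaplacianPow (k + 1) (Ψ q.1) q.2 =
        -∑ i, fderiv ℝ (fun y => fderiv ℝ (negLaplacianPow k (Ψ q.1)) y (stdVec i)) q.2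
          (stdVec i) := by
      intro q
      rw [negLaplacianPow_succ, Pi.neg_apply, ContDiffAt.laplacian_eq_sum]
      have h1 : ContDiff ℝ ∞ (negLaplacianPow k (Ψ q.1)) :=
        ih.comp (contDiff_const.prodMk contDiff_id)
      exact (h1.of_le (by norm_cast)).contDiffAt
    simp_rw [h]
    exact (ContDiff.sum fun i _ => step (Φ := fun t y => fderiv ℝ (negLaplacianPow k (Ψ t)) y
      (stdVec i)) (step (Φ := fun t => negLaplacianPow k (Ψ t)) ih _) _).neg

/-- A smooth cutoff equal to `1` on the unit ball and supported in the ball of radius `2`. -/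
noncomputable def unitCutoff : ContDiffBump (0 : 𝔼) where
  rIn := 1
  rOut := 2
  rIn_pos := one_pos
  rIn_lt_rOut := one_lt_two

/-- Testing against a function concentrated at the origin is negligible at scale `δ`. -/
theorem abs_integral_mul_negLaplacianPow_cutoff_le (k : ℕ) {u φ : 𝔼 → ℝ} (hu : Continuous u)
    (hφ : ContDiff ℝ ∞ φ) : ∃ C : ℝ, ∀ δ : ℝ, 0 < δ → δ ≤ 1 →
      |∫ x, u x * negLaplacianPow k (fun y => φ y * unitCutoff (δ⁻¹ • y)) x| ≤
        C * (δ⁻¹ ^ (2 * k) * δ ^ n) := by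
  have hη : ContDiff ℝ ∞ (unitCutoff : 𝔼 → ℝ) := unitCutoff.contDiff
  -- In the variable `z = y / δ` the localized test function is `Ψ δ`, a family smooth down to `δ =
  -- 0`. Undoing the scaling costs `δ⁻¹ ^ (2 * k)`, and the support has volume of order `δ ^ n`.
  let Ψ : ℝ → 𝔼 → ℝ := fun t z => φ (t • z) * unitCutoff z
  have hΨ : ContDiff ℝ ∞ fun q : ℝ × 𝔼 => negLaplacianPow k (Ψ q.1) q.2 := by
    refine contDiff_negLaplacianPow_param ?_ k
    exact (hφ.comp (contDiff_fst.smul contDiff_snd)).mul (hη.comp contDiff_snd)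
  obtain ⟨A, hA⟩ := ((isCompact_Icc (a := (0 : ℝ)) (b := 1)).prod
    (isCompact_closedBall (0 : 𝔼) 2)).exists_bound_of_continuousOn hΨ.continuous.continuousOn
  obtain ⟨M, hM⟩ := (isCompact_closedBall (0 : 𝔼) 2).exists_bound_of_continuousOn
    hu.continuousOn
  refine ⟨M * A * (2 ^ n * volume.real (ball (0 : 𝔼) 1)), fun δ hδ hδ1 => ?_⟩
  have hfun : (fun y : 𝔼 => φ y * unitCutoff (δ⁻¹ • y)) = fun y => Ψ δ (0 + δ⁻¹ • y) := by
    ext y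
    simp [Ψ, smul_smul, hδ.ne']
  rw [hfun, negLaplacianPow_comp_affine]
  simp only [zero_add]
  have hM0 : 0 ≤ M := (norm_nonneg _).trans (hM 0 (by simp))
  have hzero : ∀ x ∉ closedBall (0 : 𝔼) (2 * δ),
      u x * (δ⁻¹ ^ (2 * k) * negLaplacianPow k (Ψ δ) (δ⁻¹ • x)) = 0 := by
    intro x hx
    have : δ⁻¹ • x ∉ tsupport (negLaplacianPow k (Ψ δ)) := by
      intro h
      have h1 := tsupport_negLaplacianPow_subset _ _ h
      have h2 : δ⁻¹ • x ∈ tsupport (unitCutoff : 𝔼 → ℝ) := tsupport_mul_subset_right h1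
      rw [unitCutoff.tsupport_eq, mem_closedBall_zero_iff, norm_smul, norm_inv,
        Real.norm_of_nonneg hδ.le, inv_mul_le_iff₀ hδ] at h2
      apply hx
      rw [mem_closedBall_zero_iff]
      exact h2.trans_eq (mul_comm _ _)
    rw [image_eq_zero_of_notMem_tsupport this]
    simp
  rw [← setIntegral_eq_integral_of_forall_compl_eq_zero hzero, ← Real.norm_eq_abs]
  refine (norm_setIntegral_le_of_norm_le_const (C := M * (δ⁻¹ ^ (2 * k) * A))
    measure_closedBall_lt_top fun x hx => ?_).trans_eq ?_
  · rw [mem_closedBall_zero_iff] at hx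
    rw [norm_mul, norm_mul, Real.norm_of_nonneg (by positivity : 0 ≤ δ⁻¹ ^ (2 * k))]
    refine mul_le_mul (hM x ?_) (mul_le_mul_of_nonneg_left (hA (δ, δ⁻¹ • x) ⟨⟨hδ.le, hδ1⟩, ?_⟩)
      (by positivity)) (by positivity) hM0
    · rw [mem_closedBall_zero_iff]; linarith
    · rw [mem_closedBall_zero_iff, norm_smul, norm_inv, Real.norm_of_nonneg hδ.le,
        inv_mul_le_iff₀ hδ]
      linarith
  · rw [measureReal_def, Measure.addHaar_closedBall _ _ (by positivity), ENNReal.toReal_mul,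
      ENNReal.toReal_ofReal (by positivity), measureReal_def]
    simp only [finrank_euclideanSpace, Fintype.card_fin]
    rw [mul_pow]
    ring

theorem tsupport_mul_one_sub_cutoff_subset (φ : 𝔼 → ℝ) {δ : ℝ} (hδ : 0 < δ) :
    tsupport (fun y : 𝔼 => φ y - φ y * unitCutoff (δ⁻¹ • y)) ⊆ {0}ᶜ := by
  intro x hx h0
  rw [mem_singleton_iff] at h0
  subst h0
  refine notMem_tsupport_iff_eventuallyEq.2 ?_ hx
  filter_upwards [ball_mem_nhds (0 : 𝔼) hδ] with y hy
  rw [mem_ball_zero_iff] at hy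
  have : (unitCutoff : 𝔼 → ℝ) (δ⁻¹ • y) = 1 := by
    apply unitCutoff.one_of_mem_closedBall
    rw [mem_closedBall_zero_iff, norm_smul, norm_inv, Real.norm_of_nonneg hδ.le,
      inv_mul_le_iff₀ hδ]
    simpa [unitCutoff] using hy.le
  simp [this]

/-- Removability of the origin: a continuous function solving `(-Δ)^k u = f` off the origin,
with `f` locally integrable and `2 * k < n`, solves it in the sense of distributions. -/
theorem integral_mul_negLaplacianPow_eq {k : ℕ} (hk : 2 * k < n) {u f φ : 𝔼 → ℝ}
    (hu : Continuous u) (hu' : ContDiffOn ℝ (2 * k : ℕ) u {0}ᶜ)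
    (hf : LocallyIntegrable f) (huf : ∀ x, x ≠ 0 → negLaplacianPow k u x = f x)
    (hφ : ContDiff ℝ ∞ φ) (hc : HasCompactSupport φ) :
    ∫ x, u x * negLaplacianPow k φ x = ∫ x, f x * φ x := by
  have : NeZero n := ⟨by omega⟩
  have : Nontrivial 𝔼 := inferInstance
  have hη : ContDiff ℝ ∞ (unitCutoff : 𝔼 → ℝ) := unitCutoff.contDiff
  have hfφ : Integrable fun x => f x * φ x :=
    hf.integrable_smul_right_of_hasCompactSupport hφ.continuous hc
  let δ : ℕ → ℝ := fun j => 1 / ((j : ℝ) + 1)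
  have hδ0 : ∀ j, 0 < δ j := fun j => Nat.one_div_pos_of_nat
  have hδ1 : ∀ j, δ j ≤ 1 := fun j => by
    simp only [δ]
    rw [div_le_one (by positivity)]
    have := Nat.cast_nonneg (α := ℝ) j
    linarith
  have hδt : Tendsto δ atTop (𝓝 0) := tendsto_one_div_add_atTop_nhds_zero_nat
  let ψ : ℕ → 𝔼 → ℝ := fun j y => φ y * unitCutoff ((δ j)⁻¹ • y)
  have hψ : ∀ j, ContDiff ℝ ∞ (ψ j) := fun j => hφ.mul (hη.comp (contDiff_const_smul _))
  have hψc : ∀ j, HasCompactSupport (ψ j) := fun j => hc.mul_right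
  have hi : ∀ {χ : 𝔼 → ℝ}, ContDiff ℝ ∞ χ → HasCompactSupport χ →
      Integrable fun x => u x * negLaplacianPow k χ x := fun hχ hχc =>
    integrable_mul_of_tsupport_subset isOpen_univ hu.continuousOn
      (hχ.negLaplacianPow k).continuous (hχc.negLaplacianPow k) (subset_univ _)
  -- `φ - ψ j` vanishes near the origin, so the classical equation may be integrated by parts
  -- against it.
  have hstep : ∀ j, ∫ x, f x * (φ x - ψ j x) =
      (∫ x, u x * negLaplacianPow k φ x) - ∫ x, u x * negLaplacianPow k (ψ j) x := by
    intro j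
    rw [← integral_sub (hi hφ hc) (hi (hψ j) (hψc j))]
    have h := integral_negLaplacianPow_mul isOpen_compl_singleton k hu' (hφ.sub (hψ j))
      (hc.sub (hψc j)) (tsupport_mul_one_sub_cutoff_subset φ (hδ0 j))
    have h2 : (∫ x, f x * (φ x - ψ j x)) = ∫ x, negLaplacianPow k u x * (φ x - ψ j x) := by
      refine integral_congr_ae ?_
      have : ∀ᵐ x : 𝔼, x ≠ 0 := by simp [ae_iff]
      filter_upwards [this] with x hx
      rw [huf x hx]
    rw [h2]
    refine h.trans ?_
    rw [negLaplacianPow_sub hφ (hψ j)]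
    simp only [mul_sub]
  have hlim1 : Tendsto (fun j => ∫ x, u x * negLaplacianPow k (ψ j) x) atTop (𝓝 0) := by
    obtain ⟨C, hC⟩ := abs_integral_mul_negLaplacianPow_cutoff_le k hu hφ
    refine squeeze_zero_norm (a := fun j => C * δ j ^ (n - 2 * k)) (fun j => ?_) ?_
    · rw [Real.norm_eq_abs]
      refine (hC (δ j) (hδ0 j) (hδ1 j)).trans_eq ?_
      rw [inv_pow, pow_sub₀ _ (hδ0 j).ne' hk.le, mul_comm (δ j ^ n)]
    · have := (hδt.pow (n - 2 * k)).const_mul C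
      rwa [zero_pow (by omega), mul_zero] at this
  have hlim2 : Tendsto (fun j => ∫ x, f x * (φ x - ψ j x)) atTop (𝓝 (∫ x, f x * φ x)) := by
    refine tendsto_integral_of_dominated_convergence (fun x => ‖f x * φ x‖) (fun j => ?_)
      hfφ.norm (fun j => Eventually.of_forall fun x => ?_) ?_
    · exact hf.aestronglyMeasurable.mul
        (hφ.continuous.sub (hψ j).continuous).aestronglyMeasurable
    · rw [norm_mul, norm_mul]
      refine mul_le_mul_of_nonneg_left ?_ (norm_nonneg _)
      simp only [ψ]
      rw [← mul_one_sub, norm_mul]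
      refine mul_le_of_le_one_right (norm_nonneg _) ?_
      have h0 : 0 ≤ (unitCutoff : 𝔼 → ℝ) ((δ j)⁻¹ • x) := unitCutoff.nonneg
      have h1 : (unitCutoff : 𝔼 → ℝ) ((δ j)⁻¹ • x) ≤ 1 := unitCutoff.le_one
      rw [Real.norm_eq_abs, abs_le]
      constructor <;> linarith
    · have : ∀ᵐ x : 𝔼, x ≠ 0 := by simp [ae_iff]
      filter_upwards [this] with x hx
      refine tendsto_const_nhds.congr' ?_
      have hx' : 0 < ‖x‖ / 2 := by have := norm_pos_iff.2 hx; positivity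
      filter_upwards [hδt.eventually (gt_mem_nhds hx')] with j hj
      have : (unitCutoff : 𝔼 → ℝ) ((δ j)⁻¹ • x) = 0 := by
        apply unitCutoff.zero_of_le_dist
        rw [dist_zero_right, norm_smul, norm_inv, Real.norm_of_nonneg (hδ0 j).le,
          le_inv_mul_iff₀ (hδ0 j)]
        simp only [unitCutoff]
        linarith
      simp [ψ, this]
  have hlim3 : Tendsto (fun j => ∫ x, f x * (φ x - ψ j x)) atTop
      (𝓝 (∫ x, u x * negLaplacianPow k φ x)) := by
    simp_rw [hstep]
    simpa using hlim1.const_sub (∫ x, u x * negLaplacianPow k φ x)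
  exact tendsto_nhds_unique hlim3 hlim2

theorem locallyIntegrable_norm_rpow (hn : 0 < n) {a : ℝ} (ha : -(n : ℝ) < a) :
    LocallyIntegrable fun x : 𝔼 => ‖x‖ ^ a := by
  have : NeZero n := ⟨hn.ne'⟩
  have : Nontrivial 𝔼 := inferInstance
  intro x
  refine ⟨ball 0 (‖x‖ + 1), isOpen_ball.mem_nhds (by simp), ?_⟩
  rw [integrableOn_fun_norm_addHaar volume (f := fun t => t ^ a)]
  have h : IntegrableOn (fun t : ℝ => t ^ ((n : ℝ) - 1 + a)) (Ioo 0 (‖x‖ + 1)) := by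
    rw [intervalIntegral.integrableOn_Ioo_rpow_iff (by positivity)]
    linarith
  refine h.congr_fun (fun t ht => ?_) measurableSet_Ioo
  simp only [finrank_euclideanSpace, Fintype.card_fin, smul_eq_mul]
  rw [Real.rpow_add ht.1, ← Real.rpow_natCast, Nat.cast_sub hn, Nat.cast_one]

end WeakFormulation

/-! ### Mean value inequality and the Liouville-type sign argument -/

section MeanValue

variable {n : ℕ}

local notation "𝔼" => EuclideanSpace ℝ (Fin n)

/-- A smooth radial kernel, positive exactly on the open unit ball. -/
noncomputable def radialKernel (y : 𝔼) : ℝ := expNegInvGlue (1 - ‖y‖ ^ 2)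

theorem contDiff_radialKernel : ContDiff ℝ ∞ (radialKernel : 𝔼 → ℝ) :=
  expNegInvGlue.contDiff.comp (contDiff_const.sub (contDiff_norm_sq ℝ))

theorem radialKernel_nonneg (y : 𝔼) : 0 ≤ radialKernel y := expNegInvGlue.nonneg _

theorem radialKernel_pos {y : 𝔼} (hy : ‖y‖ < 1) : 0 < radialKernel y := by
  refine expNegInvGlue.pos_of_pos ?_
  nlinarith [norm_nonneg y]

theorem radialKernel_eq_zero {y : 𝔼} (hy : 1 ≤ ‖y‖) : radialKernel y = 0 := by
  refine expNegInvGlue.zero_of_nonpos ?_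
  nlinarith [norm_nonneg y]

theorem hasCompactSupport_radialKernel : HasCompactSupport (radialKernel : 𝔼 → ℝ) := by
  refine HasCompactSupport.intro (isCompact_closedBall 0 1) fun y hy => radialKernel_eq_zero ?_
  rw [mem_closedBall_zero_iff, not_le] at hy
  exact hy.le

theorem integrable_radialKernel : Integrable (radialKernel : 𝔼 → ℝ) :=
  contDiff_radialKernel.continuous.integrable_of_hasCompactSupport hasCompactSupport_radialKernel

theorem integral_radialKernel_pos : 0 < ∫ y : 𝔼, radialKernel y :=
  contDiff_radialKernel.continuous.integral_pos_of_hasCompactSupport_nonneg_nonzero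
    hasCompactSupport_radialKernel radialKernel_nonneg (x := 0) (radialKernel_pos (by simp)).ne'

/-- The radial function whose gradient is `-y * radialKernel y`. -/
noncomputable def radialPotential (y : 𝔼) : ℝ :=
  (1 / 2) * ∫ s in (‖y‖ ^ 2)..1, expNegInvGlue (1 - s)

theorem continuous_expNegInvGlue_one_sub : Continuous fun s : ℝ => expNegInvGlue (1 - s) :=
  (expNegInvGlue.contDiff (n := 0)).continuous.comp (continuous_const.sub continuous_id)

theorem hasDerivAt_potential_profile (t : ℝ) :
    HasDerivAt (fun t => (1 / 2) * ∫ s in t..1, expNegInvGlue (1 - s))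
      (-(1 / 2) * expNegInvGlue (1 - t)) t := by
  have h := (intervalIntegral.integral_hasDerivAt_left
    (continuous_expNegInvGlue_one_sub.intervalIntegrable t 1)
    (continuous_expNegInvGlue_one_sub.stronglyMeasurableAtFilter _ _)
    continuous_expNegInvGlue_one_sub.continuousAt).const_mul (1 / 2)
  exact h.congr_deriv (by ring)

theorem contDiff_radialPotential : ContDiff ℝ 1 (radialPotential : 𝔼 → ℝ) := by
  have h : ContDiff ℝ 1 fun t : ℝ => (1 / 2) * ∫ s in t..1, expNegInvGlue (1 - s) := by
    rw [contDiff_one_iff_deriv]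
    refine ⟨fun t => (hasDerivAt_potential_profile t).differentiableAt, ?_⟩
    have : deriv (fun t : ℝ => (1 / 2) * ∫ s in t..1, expNegInvGlue (1 - s)) =
        fun t => -(1 / 2) * expNegInvGlue (1 - t) :=
      funext fun t => (hasDerivAt_potential_profile t).deriv
    rw [this]
    exact continuous_const.mul continuous_expNegInvGlue_one_sub
  exact h.comp (contDiff_norm_sq ℝ)

/-- Since `y * radialKernel y` is minus a gradient, the radial derivative of a weighted average
becomes an integral of the Laplacian against the non-negative `radialPotential`. -/
theorem fderiv_radialPotential (y v : 𝔼) :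
    fderiv ℝ radialPotential y v = -(inner ℝ y v * radialKernel y) := by
  have h1 : HasFDerivAt (fun y : 𝔼 => ‖y‖ ^ 2) (2 • innerSL ℝ y) y :=
    (hasStrictFDerivAt_norm_sq y).hasFDerivAt
  have h := (hasDerivAt_potential_profile (‖y‖ ^ 2)).comp_hasFDerivAt y h1
  rw [show (radialPotential : 𝔼 → ℝ) =
    (fun t => (1 / 2) * ∫ s in t..1, expNegInvGlue (1 - s)) ∘ fun y => ‖y‖ ^ 2 from rfl, h.fderiv]
  simp [radialKernel]
  ring

theorem radialPotential_nonneg (y : 𝔼) : 0 ≤ radialPotential y := by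
  unfold radialPotential
  rcases le_total (‖y‖ ^ 2) 1 with h | h
  · exact mul_nonneg (by norm_num)
      (intervalIntegral.integral_nonneg h fun s _ => expNegInvGlue.nonneg _)
  · rw [intervalIntegral.integral_symm, intervalIntegral.integral_congr (g := fun _ => 0)]
    · simp
    · intro s hs
      rw [uIcc_of_le h] at hs
      exact expNegInvGlue.zero_of_nonpos (by linarith [hs.1])

theorem hasCompactSupport_radialPotential : HasCompactSupport (radialPotential : 𝔼 → ℝ) := by
  refine HasCompactSupport.intro (isCompact_closedBall 0 1) fun y hy => ?_
  rw [mem_closedBall_zero_iff, not_le] at hy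
  have h : 1 ≤ ‖y‖ ^ 2 := by nlinarith
  unfold radialPotential
  rw [intervalIntegral.integral_symm, intervalIntegral.integral_congr (g := fun _ => 0)]
  · simp
  · intro s hs
    rw [uIcc_of_le h] at hs
    exact expNegInvGlue.zero_of_nonpos (by linarith [hs.1])

theorem hasDerivAt_integral_comp_affine_mul_radialKernel {w : 𝔼 → ℝ} (hw : ContDiff ℝ 1 w)
    (a : 𝔼) (R : ℝ) :
    HasDerivAt (fun r : ℝ => ∫ y, w (a + r • y) * radialKernel y)
      (∫ y, fderiv ℝ w (a + R • y) y * radialKernel y) R := by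
  have hK : Continuous (radialKernel : 𝔼 → ℝ) := contDiff_radialKernel.continuous
  have hcont : Continuous fun q : ℝ × 𝔼 => fderiv ℝ w (a + q.1 • q.2) q.2 :=
    ((hw.continuous_fderiv (by norm_num)).comp (by fun_prop)).clm_apply continuous_snd
  obtain ⟨C, hC⟩ := ((isCompact_closedBall R 1).prod
    (isCompact_closedBall (0 : 𝔼) 1)).exists_bound_of_continuousOn hcont.continuousOn
  refine (hasDerivAt_integral_of_dominated_loc_of_deriv_le
    (F := fun (r : ℝ) (y : 𝔼) => w (a + r • y) * radialKernel y)
    (F' := fun (r : ℝ) (y : 𝔼) => fderiv ℝ w (a + r • y) y * radialKernel y)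
    (bound := fun y => C * radialKernel y) (ball_mem_nhds R one_pos) ?_ ?_ ?_ ?_ ?_ ?_).2
  · exact Eventually.of_forall fun r =>
      ((hw.continuous.comp (by fun_prop)).mul hK).aestronglyMeasurable
  · exact ((hw.continuous.comp (by fun_prop : Continuous fun y : 𝔼 => a + R • y)).mul
      hK).integrable_of_hasCompactSupport hasCompactSupport_radialKernel.mul_left
  · exact ((hcont.comp (Continuous.prodMk_right R)).mul hK).aestronglyMeasurable
  · refine Eventually.of_forall fun y r hr => ?_
    rw [norm_mul, Real.norm_of_nonneg (radialKernel_nonneg y)]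
    by_cases hy : ‖y‖ ≤ 1
    · exact mul_le_mul_of_nonneg_right
        (hC (r, y) ⟨ball_subset_closedBall hr, mem_closedBall_zero_iff.2 hy⟩)
        (radialKernel_nonneg y)
    · rw [radialKernel_eq_zero (not_le.1 hy).le]
      simp
  · exact integrable_radialKernel.const_mul C
  · refine Eventually.of_forall fun y r _ => ?_
    have h1 : HasDerivAt (fun r : ℝ => a + r • y) y r := by
      simpa using ((hasDerivAt_id r).smul_const y).const_add a
    exact ((hw.differentiable (by norm_num) _).hasFDerivAt.comp_hasDerivAt r h1).mul_const _

/-- The mean value inequality for superharmonic functions. -/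
theorem integral_comp_affine_mul_radialKernel_le {w : 𝔼 → ℝ} (hw : ContDiff ℝ 2 w)
    (hΔ : ∀ x, Laplacian.laplacian w x ≤ 0) (a : 𝔼) {R : ℝ} (hR : 0 ≤ R) :
    ∫ y, w (a + R • y) * radialKernel y ≤ w a * ∫ y : 𝔼, radialKernel y := by
  have hw1 : ContDiff ℝ 1 w := hw.of_le (by norm_num)
  have hd := hasDerivAt_integral_comp_affine_mul_radialKernel hw1 a
  -- With `W y = w (a + r • y)`, `r` times the derivative of the average equals `∫ ΔW *
  -- radialPotential`, which is at most zero. Comparison with `r = 0` gives the claim.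
  have hanti : AntitoneOn (fun r : ℝ => ∫ y, w (a + r • y) * radialKernel y) (Ici 0) := by
    refine antitoneOn_of_deriv_nonpos (convex_Ici 0)
      (fun r _ => (hd r).continuousAt.continuousWithinAt)
      (fun r _ => (hd r).differentiableAt.differentiableWithinAt) fun r hr => ?_
    rw [interior_Ici, mem_Ioi] at hr
    rw [(hd r).deriv]
    have hW : ContDiff ℝ 2 fun y : 𝔼 => w (a + r • y) := hw.comp (by fun_prop)
    have h := integral_laplacian_mul_eq_neg_sum isOpen_univ hW.contDiffOn
      contDiff_radialPotential hasCompactSupport_radialPotential (subset_univ _)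
    have hle : ∫ y, Laplacian.laplacian (fun y : 𝔼 => w (a + r • y)) y * radialPotential y ≤ 0 :=
      integral_nonpos fun y => by
        rw [laplacian_comp_affine]
        exact mul_nonpos_of_nonpos_of_nonneg
          (mul_nonpos_of_nonneg_of_nonpos (by positivity) (hΔ _)) (radialPotential_nonneg y)
    have hfd : ∀ y v : 𝔼, fderiv ℝ (fun y : 𝔼 => w (a + r • y)) y v =
        r * fderiv ℝ w (a + r • y) v := by
      intro y v
      rw [fderiv_comp_smul (f := fun z => w (a + z)) r, fderiv_comp_add_left]
      simp
    have hsum : -∑ i, ∫ y, fderiv ℝ (fun y : 𝔼 => w (a + r • y)) y (stdVec i) *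
        fderiv ℝ radialPotential y (stdVec i) =
        r * ∫ y, fderiv ℝ w (a + r • y) y * radialKernel y := by
      rw [← integral_finsetSum, ← integral_neg, ← integral_const_mul]
      · congr 1
        ext y
        have hy : fderiv ℝ w (a + r • y) y =
            ∑ i, inner ℝ y (stdVec i) * fderiv ℝ w (a + r • y) (stdVec i) := by
          have h := congrArg (fderiv ℝ w (a + r • y))
            ((EuclideanSpace.basisFun (Fin n) ℝ).sum_repr' y)
          rw [← h, map_sum]
          refine Finset.sum_congr rfl fun i _ => ?_
          rw [map_smul, smul_eq_mul, real_inner_comm]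
        rw [hy, Finset.sum_mul, Finset.mul_sum, ← Finset.sum_neg_distrib]
        refine Finset.sum_congr rfl fun i _ => ?_
        rw [hfd, fderiv_radialPotential]
        ring
      · exact fun i _ => integrable_mul_of_tsupport_subset isOpen_univ
          ((hW.continuous_fderiv (by norm_num)).clm_apply continuous_const).continuousOn
          ((contDiff_radialPotential.continuous_fderiv (by norm_num)).clm_apply continuous_const)
          (hasCompactSupport_radialPotential.fderiv_apply (𝕜 := ℝ) _) (subset_univ _)
    rw [h, hsum] at hle
    exact nonpos_of_mul_nonpos_right hle hr
  have := hanti (self_mem_Ici (a := (0 : ℝ))) hR hR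
  simpa [integral_const_mul] using this

/-- Liouville-type positivity: a smooth `v` with `(-Δ)^m v ≥ 0` and vanishing rescaled averages
has `(-Δ)^k v ≥ 0` for every `k ≤ m`. -/
theorem negLaplacianPow_nonneg_of_averages_tendsto {v : 𝔼 → ℝ} (hv : ContDiff ℝ ∞ v) {m : ℕ}
    (hm : ∀ x, 0 ≤ negLaplacianPow m v x)
    (hav : ∀ a : 𝔼, Tendsto (fun R : ℝ => ∫ y in closedBall (0 : 𝔼) 1, |v (a + R • y)|)
      atTop (𝓝 0)) :
    ∀ k ≤ m, ∀ x, 0 ≤ negLaplacianPow k v x := by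
  intro k hk
  induction hk using Nat.decreasingInduction with
  | self => exact hm
  | of_succ k hk ih =>
    intro a
    have hw : ContDiff ℝ ∞ (negLaplacianPow k v) := hv.negLaplacianPow k
    have hmv : ∀ R : ℝ, 0 ≤ R → ∫ y, negLaplacianPow k v (a + R • y) * radialKernel y ≤
        negLaplacianPow k v a * ∫ y : 𝔼, radialKernel y := fun R hR =>
      integral_comp_affine_mul_radialKernel_le (hw.of_le (by norm_cast)) (fun x => by
        have := ih x
        rw [negLaplacianPow_succ, Pi.neg_apply] at this
        linarith) a hR
    obtain ⟨C, hC⟩ := (isCompact_closedBall (0 : 𝔼) 1).exists_bound_of_continuousOn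
      ((contDiff_radialKernel (n := n)).negLaplacianPow k).continuous.continuousOn
    have hC0 : 0 ≤ C := (norm_nonneg _).trans (hC 0 (by simp))
    have hlim : Tendsto (fun R : ℝ => ∫ y, negLaplacianPow k v (a + R • y) * radialKernel y)
        atTop (𝓝 0) := by
      have h0 : Tendsto (fun R : ℝ => C * ∫ y in closedBall (0 : 𝔼) 1, |v (a + R • y)|)
          atTop (𝓝 0) := by simpa using (hav a).const_mul C
      refine squeeze_zero_norm' ?_ h0
      filter_upwards [eventually_ge_atTop 1] with R hR
      have hV : ContDiff ℝ ∞ fun y : 𝔼 => v (a + R • y) := hv.comp (by fun_prop)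
      -- All Laplacians move onto the kernel. The chain rule gives a factor `R ^ (2 * k) ≥ 1` on the
      -- left, so the average of `(-Δ)^k v` is controlled by that of `|v|`.
      have hbp := integral_negLaplacianPow_mul isOpen_univ k
        (contDiff_infty.1 hV _).contDiffOn contDiff_radialKernel
        hasCompactSupport_radialKernel (subset_univ _)
      rw [negLaplacianPow_comp_affine] at hbp
      simp_rw [mul_assoc] at hbp
      rw [integral_const_mul] at hbp
      have hR1 : 1 ≤ R ^ (2 * k) := one_le_pow₀ hR
      have hbound : ‖∫ y, v (a + R • y) * negLaplacianPow k radialKernel y‖ ≤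
          C * ∫ y in closedBall (0 : 𝔼) 1, |v (a + R • y)| := by
        rw [← setIntegral_eq_integral_of_forall_compl_eq_zero (s := closedBall (0 : 𝔼) 1),
          ← integral_const_mul]
        · refine norm_integral_le_of_norm_le
            ((continuous_const.mul hV.continuous.abs).continuousOn.integrableOn_compact
              (isCompact_closedBall _ _)) ?_
          refine (ae_restrict_iff' measurableSet_closedBall).2 (Eventually.of_forall fun y hy => ?_)
          rw [norm_mul, mul_comm, Real.norm_eq_abs (v _)]
          exact mul_le_mul_of_nonneg_right (hC y hy) (abs_nonneg _)
        · intro y hy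
          have : y ∉ tsupport (negLaplacianPow k (radialKernel : 𝔼 → ℝ)) := fun h => hy <|
            closure_minimal (t := closedBall (0 : 𝔼) 1) (fun z hz => by
              by_contra hz'
              rw [mem_closedBall_zero_iff, not_le] at hz'
              exact hz (radialKernel_eq_zero hz'.le)) isClosed_closedBall
              (tsupport_negLaplacianPow_subset _ _ h)
          rw [image_eq_zero_of_notMem_tsupport this, mul_zero]
      rw [← hbp, norm_mul, Real.norm_of_nonneg (by positivity)] at hbound
      exact (le_mul_of_one_le_left (norm_nonneg _) hR1).trans hbound
    have hge : 0 ≤ negLaplacianPow k v a * ∫ y : 𝔼, radialKernel y :=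
      le_of_tendsto hlim ((eventually_ge_atTop 0).mono hmv)
    exact nonneg_of_mul_nonneg_left hge integral_radialKernel_pos

end MeanValue

/-! ### Universal integral bound and decay of averages by scaling -/

section LocalBound

variable {n : ℕ}

local notation "𝔼" => EuclideanSpace ℝ (Fin n)

/-- A derivative costs one power of `χ`. Iterated, this bounds `(-Δ)^m χ^(s+2m)` by a multiple of
`χ^s` on compact sets. -/
theorem exists_fderiv_pow_mul {χ g : 𝔼 → ℝ} (hχ : ContDiff ℝ ∞ χ) (hg : ContDiff ℝ ∞ g) (s : ℕ)
    (v : 𝔼) : ∃ g' : 𝔼 → ℝ, ContDiff ℝ ∞ g' ∧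
      (fun x => fderiv ℝ (fun y => χ y ^ (s + 1) * g y) x v) = fun x => χ x ^ s * g' x := by
  have hd : ∀ {h : 𝔼 → ℝ}, ContDiff ℝ ∞ h → ContDiff ℝ ∞ fun x => fderiv ℝ h x v := fun hh =>
    (hh.fderiv_right (m := ∞) (by simp)).clm_apply contDiff_const
  refine ⟨fun x => (s + 1) * fderiv ℝ χ x v * g x + χ x * fderiv ℝ g x v,
    ((contDiff_const.mul (hd hχ)).mul hg).add (hχ.mul (hd hg)), ?_⟩
  ext x
  have h1 : HasFDerivAt χ (fderiv ℝ χ x) x := (hχ.differentiable (by simp) x).hasFDerivAt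
  have h2 : HasFDerivAt g (fderiv ℝ g x) x := (hg.differentiable (by simp) x).hasFDerivAt
  have h3 : HasFDerivAt (fun y => χ y ^ (s + 1) * g y) _ x := (h1.pow (s + 1)).mul h2
  rw [h3.fderiv]
  simp
  ring

theorem exists_laplacian_pow_mul {χ g : 𝔼 → ℝ} (hχ : ContDiff ℝ ∞ χ) (hg : ContDiff ℝ ∞ g)
    (s : ℕ) : ∃ g' : 𝔼 → ℝ, ContDiff ℝ ∞ g' ∧
      Laplacian.laplacian (fun y => χ y ^ (s + 2) * g y) = fun x => χ x ^ s * g' x := by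
  choose g₁ hg₁ h₁ using exists_fderiv_pow_mul hχ hg (s + 1)
  choose g₂ hg₂ h₂ using fun v => exists_fderiv_pow_mul hχ (hg₁ v) s v
  refine ⟨fun x => ∑ i, g₂ (stdVec i) x, ContDiff.sum fun i _ => hg₂ _, ?_⟩
  ext x
  have hc : ContDiff ℝ ∞ fun y => χ y ^ (s + 2) * g y := (hχ.pow _).mul hg
  rw [(hc.of_le (by norm_cast)).contDiffAt.laplacian_eq_sum, Finset.mul_sum]
  refine Finset.sum_congr rfl fun i _ => ?_
  rw [h₁, ← congrFun (h₂ _) x]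

theorem exists_negLaplacianPow_pow_mul {χ g : 𝔼 → ℝ} (hχ : ContDiff ℝ ∞ χ)
    (hg : ContDiff ℝ ∞ g) (k s : ℕ) : ∃ g' : 𝔼 → ℝ, ContDiff ℝ ∞ g' ∧
      negLaplacianPow k (fun y => χ y ^ (s + 2 * k) * g y) = fun x => χ x ^ s * g' x := by
  induction k generalizing s with
  | zero => exact ⟨g, hg, rfl⟩
  | succ k ih =>
    obtain ⟨g₁, hg₁, h₁⟩ := ih (s + 2)
    obtain ⟨g₂, hg₂, h₂⟩ := exists_laplacian_pow_mul hχ hg₁ s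
    refine ⟨-g₂, hg₂.neg, ?_⟩
    rw [negLaplacianPow_succ, show s + 2 * (k + 1) = s + 2 + 2 * k by ring, h₁, h₂]
    ext x
    simp

/-- Young's inequality for `a^(σ/p) u φ^(1/p)` and `c a^(-σ/p)` with exponents `p` and `p/(p-1)`,
the factors `1/p` and `(p-1)/p` being dropped. Here `a` will be `‖x‖`. -/
theorem young_weighted {a u φ c σ p : ℝ} (ha : 0 < a) (hu : 0 ≤ u) (hφ : 0 ≤ φ) (hc : 0 ≤ c)
    (hp : 1 < p) : c * (u * φ ^ (1 / p)) ≤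
      a ^ σ * u ^ p * φ + c ^ (p / (p - 1)) * a ^ (-σ / (p - 1)) := by
  have hp0 : 0 < p := by linarith
  have hp1 : 0 < p - 1 := by linarith
  have hpq : p.HolderConjugate (p / (p - 1)) := Real.HolderConjugate.conjExponent hp
  have hX : 0 ≤ a ^ (σ / p) * u * φ ^ (1 / p) := by positivity
  have hY : 0 ≤ c * a ^ (-(σ / p)) := by positivity
  have h := Real.young_inequality_of_nonneg hX hY hpq
  have e1 : a ^ (σ / p) * u * φ ^ (1 / p) * (c * a ^ (-(σ / p))) = c * (u * φ ^ (1 / p)) := by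
    have : a ^ (σ / p) * a ^ (-(σ / p)) = 1 := by rw [← Real.rpow_add ha]; simp
    calc _ = a ^ (σ / p) * a ^ (-(σ / p)) * (c * (u * φ ^ (1 / p))) := by ring
      _ = _ := by rw [this, one_mul]
  have e2 : (a ^ (σ / p) * u * φ ^ (1 / p)) ^ p = a ^ σ * u ^ p * φ := by
    rw [Real.mul_rpow (by positivity) (by positivity), Real.mul_rpow (by positivity) hu,
      ← Real.rpow_mul ha.le, ← Real.rpow_mul hφ, div_mul_cancel₀ _ hp0.ne',
      div_mul_cancel₀ _ hp0.ne', Real.rpow_one]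
  have e3 : (c * a ^ (-(σ / p))) ^ (p / (p - 1)) =
      c ^ (p / (p - 1)) * a ^ (-σ / (p - 1)) := by
    rw [Real.mul_rpow hc (by positivity), ← Real.rpow_mul ha.le]
    congr 2
    field_simp
  rw [e1, e2, e3] at h
  refine h.trans (add_le_add (div_le_self (by positivity) hp.le)
    (div_le_self (by positivity) hpq.symm.lt.le))

/-- A non-negative continuous function, `C^{2m}` off the origin, solving
`(-Δ)^m u = |x|^σ u^p` off the origin. -/
structure IsPuncturedSolution (m : ℕ) (σ p : ℝ) (u : 𝔼 → ℝ) : Prop where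
  nonneg : ∀ x, 0 ≤ u x
  continuous : Continuous u
  contDiffOn : ContDiffOn ℝ (2 * m : ℕ) u {0}ᶜ
  equation : ∀ x, x ≠ 0 → negLaplacianPow m u x = ‖x‖ ^ σ * u x ^ p

theorem IsClassicalSolution.isPuncturedSolution {m : ℕ} {σ p : ℝ} {u : 𝔼 → ℝ}
    (hu : IsClassicalSolution m σ p u) : IsPuncturedSolution m σ p u := by
  rcases le_or_gt 0 σ with h | h
  · exact ⟨hu.nonneg, (hu.regular_of_nonneg h).continuous, (hu.regular_of_nonneg h).contDiffOn,
      fun x _ => hu.equation_of_nonneg h x⟩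
  · exact ⟨hu.nonneg, hu.continuous_of_neg h, hu.regular_of_neg h, hu.equation_of_neg h⟩

namespace IsPuncturedSolution

variable {m : ℕ} {σ p : ℝ} {u : EuclideanSpace ℝ (Fin n) → ℝ}

theorem locallyIntegrable_rhs (hn : 0 < n) (hσ : -(n : ℝ) < σ) (hp : 1 < p)
    (hu : IsPuncturedSolution m σ p u) :
    LocallyIntegrable fun x : 𝔼 => ‖x‖ ^ σ * u x ^ p := by
  have h := (locallyIntegrable_norm_rpow hn hσ)
  have hc : Continuous fun x => u x ^ p :=
    hu.continuous.rpow_const fun x => Or.inr (by linarith)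
  rw [← locallyIntegrableOn_univ] at h ⊢
  exact h.mul_continuousOn hc.continuousOn isClosed_univ.isLocallyClosed

theorem integral_mul_negLaplacianPow (hn : 2 * m < n) (hσ : -(2 * (m : ℝ)) < σ) (hp : 1 < p)
    (hu : IsPuncturedSolution m σ p u) {φ : 𝔼 → ℝ} (hφ : ContDiff ℝ ∞ φ)
    (hc : HasCompactSupport φ) :
    ∫ x, u x * negLaplacianPow m φ x = ∫ x, ‖x‖ ^ σ * u x ^ p * φ x := by
  have hn' : 2 * (m : ℝ) < n := by exact_mod_cast hn
  exact integral_mul_negLaplacianPow_eq hn hu.continuous hu.contDiffOn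
    (hu.locallyIntegrable_rhs (by omega) (by linarith) hp) hu.equation hφ hc

/-- The bound must not depend on the solution, since it is applied to all rescalings of one
solution. `hσp` makes the weight `‖x‖ ^ (-σ / (p - 1))` left by Young's inequality integrable at the
origin. -/
theorem exists_integral_unitBall_le (hn : 2 * m < n) (hσ : -(2 * (m : ℝ)) < σ) (hp : 1 < p)
    (hσp : -(n : ℝ) < -σ / (p - 1)) :
    ∃ C : ℝ, ∀ u : 𝔼 → ℝ, IsPuncturedSolution m σ p u →
      ∫ x in closedBall (0 : 𝔼) 1, u x ≤ C := by
  have hn0 : 0 < n := by omega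
  have : NeZero n := ⟨hn0.ne'⟩
  have : Nontrivial 𝔼 := inferInstance
  have hn' : 2 * (m : ℝ) < n := by exact_mod_cast hn
  have hp0 : 0 < p := by linarith
  have hp1 : 0 < p - 1 := by linarith
  have hae : ∀ᵐ x : 𝔼, x ≠ 0 := by simp [ae_iff]
  -- This size of `s` gives `(s + 2m) / p ≤ s`, hence `χ^s ≤ φ^(1/p)` for `φ = χ^(s+2m)`, the form
  -- required by Young's inequality.
  obtain ⟨s, hs⟩ := exists_nat_ge (2 * (m : ℝ) / (p - 1) + 1)
  have hs1 : (1 : ℝ) ≤ s := le_trans (le_add_of_nonneg_left (by positivity)) hs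
  have hs0 : s ≠ 0 := by rintro rfl; norm_num at hs1
  have hsp : ((s + 2 * m : ℕ) : ℝ) * (1 / p) ≤ s := by
    have h : 2 * (m : ℝ) / (p - 1) ≤ s := by linarith
    rw [div_le_iff₀ hp1] at h
    rw [mul_one_div, div_le_iff₀ hp0]
    push_cast
    linarith
  let χ : 𝔼 → ℝ := unitCutoff
  have hχ : ContDiff ℝ ∞ χ := unitCutoff.contDiff
  have hχ0 : ∀ x, 0 ≤ χ x := fun x => unitCutoff.nonneg
  have hχ1 : ∀ x, χ x ≤ 1 := fun x => unitCutoff.le_one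
  have hχout : ∀ x ∉ closedBall (0 : 𝔼) 2, χ x = 0 := fun x hx => by
    apply unitCutoff.zero_of_le_dist
    rw [mem_closedBall, not_le] at hx
    exact hx.le
  have hχin : ∀ x ∈ closedBall (0 : 𝔼) 1, χ x = 1 := fun x hx =>
    unitCutoff.one_of_mem_closedBall hx
  let φ : 𝔼 → ℝ := fun x => χ x ^ (s + 2 * m)
  have hφ : ContDiff ℝ ∞ φ := hχ.pow _
  have hφ0 : ∀ x, 0 ≤ φ x := fun x => pow_nonneg (hχ0 x) _
  have hφc : HasCompactSupport φ :=
    HasCompactSupport.intro (isCompact_closedBall (0 : 𝔼) 2) fun x hx => by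
      simp only [φ, hχout x hx]
      exact zero_pow (by omega)
  obtain ⟨g, hg, hgφ⟩ := exists_negLaplacianPow_pow_mul hχ (contDiff_const (c := (1 : ℝ))) m s
  simp only [mul_one] at hgφ
  obtain ⟨C, hC⟩ := (isCompact_closedBall (0 : 𝔼) 2).exists_bound_of_continuousOn
    hg.continuous.continuousOn
  have hC0 : 0 ≤ C := (norm_nonneg _).trans (hC 0 (by simp))
  have hLφ : ∀ x, negLaplacianPow m φ x ≤ C * χ x ^ s := by
    intro x
    rw [show negLaplacianPow m φ = fun x => χ x ^ s * g x from hgφ]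
    by_cases hx : x ∈ closedBall (0 : 𝔼) 2
    · rw [mul_comm C]
      exact mul_le_mul_of_nonneg_left ((le_abs_self _).trans (hC x hx)) (pow_nonneg (hχ0 x) _)
    · simp [hχout x hx, hs0]
  have hχφ : ∀ x, χ x ^ s ≤ φ x ^ (1 / p) := by
    intro x
    rcases (hχ0 x).eq_or_lt with h | h
    · rw [← h, zero_pow hs0]
      exact Real.rpow_nonneg (hφ0 x) _
    · simp only [φ]
      rw [← Real.rpow_natCast, ← Real.rpow_natCast, ← Real.rpow_mul h.le]
      exact Real.rpow_le_rpow_of_exponent_ge h (hχ1 x) hsp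
  have hw : LocallyIntegrable fun x : 𝔼 => ‖x‖ ^ (-σ / (p - 1)) :=
    locallyIntegrable_norm_rpow hn0 hσp
  have hwK : ∀ r : ℝ, IntegrableOn (fun x : 𝔼 => ‖x‖ ^ (-σ / (p - 1))) (closedBall 0 r) :=
    fun r => hw.integrableOn_isCompact (isCompact_closedBall _ _)
  refine ⟨(2 * C) ^ (p / (p - 1)) * (∫ x in closedBall (0 : 𝔼) 2, ‖x‖ ^ (-σ / (p - 1))) +
    ∫ x in closedBall (0 : 𝔼) 1, ‖x‖ ^ (-σ / (p - 1)), fun u hu => ?_⟩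
  have hfl := hu.locallyIntegrable_rhs hn0 (by linarith) hp
  have hf0 : ∀ x, 0 ≤ ‖x‖ ^ σ * u x ^ p := fun x =>
    mul_nonneg (Real.rpow_nonneg (norm_nonneg _) _) (Real.rpow_nonneg (hu.nonneg x) _)
  have hfφ : Integrable fun x => ‖x‖ ^ σ * u x ^ p * φ x :=
    hfl.integrable_smul_right_of_hasCompactSupport hφ.continuous hφc
  have hweak := hu.integral_mul_negLaplacianPow hn hσ hp hφ hφc
  have hwi : Integrable ((closedBall (0 : 𝔼) 2).indicator
      fun x => (2 * C) ^ (p / (p - 1)) * ‖x‖ ^ (-σ / (p - 1))) :=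
    IntegrableOn.integrable_indicator ((hwK 2).const_mul _) measurableSet_closedBall
  -- The factor `2` allows absorption: by the weak equation the left side is twice the first
  -- integral on the right.
  have hstep : 2 * ∫ x, u x * negLaplacianPow m φ x ≤ (∫ x, ‖x‖ ^ σ * u x ^ p * φ x) +
      (2 * C) ^ (p / (p - 1)) * ∫ x in closedBall (0 : 𝔼) 2, ‖x‖ ^ (-σ / (p - 1)) := by
    rw [← integral_const_mul, ← integral_const_mul, ← integral_indicator measurableSet_closedBall,
      ← integral_add hfφ hwi]
    refine integral_mono_ae ?_ (hfφ.add
      hwi) ?_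
    · exact (integrable_mul_of_tsupport_subset isOpen_univ hu.continuous.continuousOn
        (hφ.negLaplacianPow m).continuous (hφc.negLaplacianPow m) (subset_univ _)).const_mul 2
    · filter_upwards [hae] with x hx
      have h1 : 2 * (u x * negLaplacianPow m φ x) ≤ 2 * C * (u x * χ x ^ s) := by
        have := mul_le_mul_of_nonneg_left (hLφ x) (hu.nonneg x)
        linarith
      refine h1.trans ?_
      by_cases hxb : x ∈ closedBall (0 : 𝔼) 2
      · rw [indicator_of_mem hxb]
        refine le_trans ?_ (young_weighted (norm_pos_iff.2 hx) (hu.nonneg x) (hφ0 x)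
          (by positivity : 0 ≤ 2 * C) hp)
        exact mul_le_mul_of_nonneg_left (mul_le_mul_of_nonneg_left (hχφ x) (hu.nonneg x))
          (by positivity)
      · rw [indicator_of_notMem hxb, hχout x hxb, zero_pow hs0]
        simpa using mul_nonneg (hf0 x) (hφ0 x)
  rw [hweak] at hstep
  -- Young's inequality again, now with `c = φ = 1`, passes from the nonlinear term back to `u`.
  have hball : ∫ x in closedBall (0 : 𝔼) 1, u x ≤
      (∫ x in closedBall (0 : 𝔼) 1, ‖x‖ ^ σ * u x ^ p) +
        ∫ x in closedBall (0 : 𝔼) 1, ‖x‖ ^ (-σ / (p - 1)) := by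
    have hfi := hfl.integrableOn_isCompact (isCompact_closedBall (0 : 𝔼) 1)
    rw [← integral_add hfi (hwK 1)]
    refine integral_mono_ae
      (hu.continuous.continuousOn.integrableOn_compact (isCompact_closedBall _ _))
      (hfi.add (hwK 1)) (ae_restrict_of_ae ?_)
    filter_upwards [hae] with x hx
    simpa using young_weighted (σ := σ) (norm_pos_iff.2 hx) (hu.nonneg x) zero_le_one zero_le_one hp
  have hle : ∫ x in closedBall (0 : 𝔼) 1, ‖x‖ ^ σ * u x ^ p ≤
      ∫ x, ‖x‖ ^ σ * u x ^ p * φ x := by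
    rw [← integral_indicator measurableSet_closedBall]
    refine integral_mono ((hfl.integrableOn_isCompact (isCompact_closedBall (0 : 𝔼) 1)
      ).integrable_indicator measurableSet_closedBall) hfφ fun x => ?_
    by_cases hx : x ∈ closedBall (0 : 𝔼) 1
    · rw [indicator_of_mem hx]
      simp [φ, hχin x hx]
    · rw [indicator_of_notMem hx]
      exact mul_nonneg (hf0 x) (hφ0 x)
  linarith

theorem rescale (hp : 1 < p) (hu : IsPuncturedSolution m σ p u) {R : ℝ} (hR : 0 < R) :
    IsPuncturedSolution m σ p fun x => R ^ ((2 * m + σ) / (p - 1)) * u (R • x) := by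
  have hp1 : p - 1 ≠ 0 := by linarith
  refine ⟨fun x => mul_nonneg (by positivity) (hu.nonneg _),
    continuous_const.mul (hu.continuous.comp (continuous_const_smul R)),
    contDiffOn_const.mul (hu.contDiffOn.comp (contDiff_const_smul R).contDiffOn fun x hx => ?_),
    fun x hx => ?_⟩
  · simpa [hR.ne'] using hx
  · have h := negLaplacianPow_comp_affine u 0 R m
    simp only [zero_add] at h
    rw [negLaplacianPow_const_mul, h]
    simp only
    rw [hu.equation (R • x) (by simp [hR.ne', hx]), norm_smul, Real.norm_of_nonneg hR.le,
      Real.mul_rpow hR.le (norm_nonneg x), Real.mul_rpow (by positivity) (hu.nonneg _),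
      ← Real.rpow_mul hR.le]
    -- The scaling exponent `α` is the one for which `α p = α + 2m + σ`.
    have e : R ^ ((2 * m + σ) / (p - 1) * p) =
        R ^ ((2 * m + σ) / (p - 1)) * R ^ (2 * m) * R ^ σ := by
      rw [← Real.rpow_natCast R (2 * m), ← Real.rpow_add hR, ← Real.rpow_add hR]
      congr 1
      push_cast
      field_simp
      ring
    rw [e]
    ring

theorem tendsto_integral_unitBall_dilation (hn : 2 * m < n) (hσ : -(2 * (m : ℝ)) < σ)
    (hp : 1 < p) (hσp : -(n : ℝ) < -σ / (p - 1)) (hu : IsPuncturedSolution m σ p u) :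
    Tendsto (fun R : ℝ => ∫ x in closedBall (0 : 𝔼) 1, u (R • x)) atTop (𝓝 0) := by
  obtain ⟨C, hC⟩ := exists_integral_unitBall_le (n := n) hn hσ hp hσp
  have hα : 0 < (2 * m + σ) / (p - 1) := div_pos (by linarith) (by linarith)
  have hlim : Tendsto (fun R : ℝ => C * R ^ (-((2 * m + σ) / (p - 1)))) atTop (𝓝 0) := by
    simpa using (tendsto_rpow_neg_atTop hα).const_mul C
  refine tendsto_of_tendsto_of_tendsto_of_le_of_le' tendsto_const_nhds hlim
    (Eventually.of_forall fun R => integral_nonneg fun x => hu.nonneg _) ?_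
  filter_upwards [eventually_gt_atTop 0] with R hR
  have h := hC _ (hu.rescale hp hR)
  rw [integral_const_mul] at h
  rw [Real.rpow_neg hR.le, ← div_eq_mul_inv, le_div_iff₀' (by positivity)]
  exact h

end IsPuncturedSolution

end LocalBound

/-! ### Mollification and its commutation with iterated Laplacians -/

section Mollification

variable {n : ℕ}

local notation "𝔼" => EuclideanSpace ℝ (Fin n)

/-- The convolution of two real functions. -/
noncomputable def mollify (φ u : 𝔼 → ℝ) (x : 𝔼) : ℝ := ∫ y, u y * φ (x - y)

theorem mollify_eq_convolution (φ u : 𝔼 → ℝ) :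
    mollify φ u = u ⋆[ContinuousLinearMap.mul ℝ ℝ, volume] φ := rfl

theorem contDiff_mollify {φ u : 𝔼 → ℝ} (hu : Continuous u) (hφ : ContDiff ℝ ∞ φ)
    (hc : HasCompactSupport φ) : ContDiff ℝ ∞ (mollify φ u) := by
  rw [mollify_eq_convolution]
  exact hc.contDiff_convolution_right (n := ⊤) _ hu.locallyIntegrable hφ

theorem fderiv_mollify {φ u : 𝔼 → ℝ} (hu : Continuous u) (hφ : ContDiff ℝ ∞ φ)
    (hc : HasCompactSupport φ) (v : 𝔼) :
    (fun x => fderiv ℝ (mollify φ u) x v) = mollify (fun x => fderiv ℝ φ x v) u := by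
  ext x
  rw [mollify_eq_convolution, (hc.hasFDerivAt_convolution_right (ContinuousLinearMap.mul ℝ ℝ)
    hu.locallyIntegrable (hφ.of_le (by norm_cast)) x).fderiv,
    convolution_precompR_apply _ hu.locallyIntegrable (hc.fderiv ℝ)
      (hφ.continuous_fderiv (by simp))]
  rfl

theorem laplacian_mollify {φ u : 𝔼 → ℝ} (hu : Continuous u) (hφ : ContDiff ℝ ∞ φ)
    (hc : HasCompactSupport φ) :
    Laplacian.laplacian (mollify φ u) = mollify (Laplacian.laplacian φ) u := by
  have hφ1 : ∀ i : Fin n, ContDiff ℝ ∞ fun x => fderiv ℝ φ x (stdVec i) := fun i =>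
    (hφ.fderiv_right (m := ∞) (by simp)).clm_apply contDiff_const
  have hφ2 : ∀ i : Fin n, ContDiff ℝ ∞
      fun x => fderiv ℝ (fun y => fderiv ℝ φ y (stdVec i)) x (stdVec i) := fun i =>
    ((hφ1 i).fderiv_right (m := ∞) (by simp)).clm_apply contDiff_const
  have hc1 : ∀ i : Fin n, HasCompactSupport fun x => fderiv ℝ φ x (stdVec i) := fun i =>
    hc.fderiv_apply (𝕜 := ℝ) _
  ext x
  rw [((contDiff_mollify hu hφ hc).of_le (by norm_cast)).contDiffAt.laplacian_eq_sum]
  simp only [mollify]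
  simp_rw [fun y => ((hφ.of_le (by norm_cast)).contDiffAt (x := y)).laplacian_eq_sum,
    Finset.mul_sum]
  rw [integral_finsetSum]
  · refine Finset.sum_congr rfl fun i _ => ?_
    rw [fderiv_mollify hu hφ hc]
    exact congrFun (fderiv_mollify hu (hφ1 i) (hc1 i) _) x
  · intro i _
    exact (hu.mul ((hφ2 i).continuous.comp (by fun_prop))).integrable_of_hasCompactSupport
      (((hc1 i).fderiv_apply (𝕜 := ℝ) _).comp_homeomorph (Homeomorph.subLeft x)).mul_left

theorem negLaplacianPow_mollify {φ u : 𝔼 → ℝ} (hu : Continuous u) (hφ : ContDiff ℝ ∞ φ)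
    (hc : HasCompactSupport φ) (k : ℕ) :
    negLaplacianPow k (mollify φ u) = mollify (negLaplacianPow k φ) u := by
  induction k with
  | zero => rfl
  | succ k ih =>
    rw [negLaplacianPow_succ, ih, laplacian_mollify hu (hφ.negLaplacianPow k)
      (hc.negLaplacianPow k), negLaplacianPow_succ]
    ext x
    simp [mollify, integral_neg]

/-- The operator has even order, so it is unaffected by the reflection `y ↦ x - y`. The value at `x`
is thus `u` tested against `(-Δ)^k` of a translate, which is where the weak equation applies. -/
theorem negLaplacianPow_mollify_apply {φ u : 𝔼 → ℝ} (hu : Continuous u) (hφ : ContDiff ℝ ∞ φ)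
    (hc : HasCompactSupport φ) (k : ℕ) (x : 𝔼) :
    negLaplacianPow k (mollify φ u) x =
      ∫ y, u y * negLaplacianPow k (fun y => φ (x - y)) y := by
  rw [negLaplacianPow_mollify hu hφ hc]
  have h := negLaplacianPow_comp_affine φ x (-1) k
  simp only [neg_smul, one_smul, ← sub_eq_add_neg, even_two_mul k |>.neg_one_pow, one_mul] at h
  rw [h]
  rfl

theorem hasCompactSupport_comp_sub {φ : 𝔼 → ℝ} (hc : HasCompactSupport φ) (x : 𝔼) :
    HasCompactSupport fun y => φ (x - y) :=
  hc.comp_homeomorph (Homeomorph.subLeft x)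

/-- A smooth non-negative mollifier of mass one supported in the ball of radius `ε`. -/
structure IsMollifier (ε : ℝ) (ρ : 𝔼 → ℝ) : Prop where
  contDiff : ContDiff ℝ ∞ ρ
  nonneg : ∀ x, 0 ≤ ρ x
  integral_eq_one : ∫ x, ρ x = 1
  tsupport_subset : tsupport ρ ⊆ closedBall 0 ε

theorem exists_isMollifier {ε : ℝ} (hε : 0 < ε) : ∃ ρ : 𝔼 → ℝ, IsMollifier ε ρ := by
  let b : ContDiffBump (0 : 𝔼) := ⟨ε / 2, ε, by positivity, by linarith⟩
  exact ⟨b.normed volume, b.contDiff_normed, b.nonneg_normed, b.integral_normed,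
    b.tsupport_normed_eq.subset⟩

namespace IsMollifier

variable {ε : ℝ} {ρ u : EuclideanSpace ℝ (Fin n) → ℝ}

theorem hasCompactSupport (hρ : IsMollifier ε ρ) : HasCompactSupport ρ :=
  (isCompact_closedBall _ _).of_isClosed_subset (isClosed_tsupport _) hρ.tsupport_subset

theorem eq_zero (hρ : IsMollifier ε ρ) {x : 𝔼} (hx : ε < ‖x‖) : ρ x = 0 := by
  refine image_eq_zero_of_notMem_tsupport fun h => ?_
  have := hρ.tsupport_subset h
  rw [mem_closedBall_zero_iff] at this
  linarith

theorem contDiff_comp_sub (hρ : IsMollifier ε ρ) (x : 𝔼) : ContDiff ℝ ∞ fun y => ρ (x - y) :=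
  hρ.contDiff.comp (contDiff_const.sub contDiff_id)

theorem tsupport_comp_sub_subset (hρ : IsMollifier ε ρ) (x : 𝔼) :
    tsupport (fun y => ρ (x - y)) ⊆ closedBall x ε := by
  refine closure_minimal (fun y hy => ?_) isClosed_closedBall
  by_contra h
  rw [mem_closedBall, not_le, dist_comm, dist_eq_norm] at h
  exact hy (hρ.eq_zero h)

theorem integral_comp_sub (hρ : IsMollifier ε ρ) (x : 𝔼) : ∫ y, ρ (x - y) = 1 := by
  rw [integral_sub_left_eq_self ρ volume x, hρ.integral_eq_one]

theorem negLaplacianPow_mollify_eq (hρ : IsMollifier ε ρ) (hu : Continuous u) {Ω : Set 𝔼}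
    (hΩ : IsOpen Ω) {k : ℕ} (huk : ContDiffOn ℝ (2 * k : ℕ) u Ω) {x : 𝔼}
    (hx : closedBall x ε ⊆ Ω) :
    negLaplacianPow k (mollify ρ u) x = ∫ y, negLaplacianPow k u y * ρ (x - y) := by
  rw [negLaplacianPow_mollify_apply hu hρ.contDiff hρ.hasCompactSupport]
  exact (integral_negLaplacianPow_mul hΩ k huk (hρ.contDiff_comp_sub x)
    (hasCompactSupport_comp_sub hρ.hasCompactSupport x)
    ((hρ.tsupport_comp_sub_subset x).trans hx)).symm

theorem integrable_negLaplacianPow_mul (hρ : IsMollifier ε ρ) {Ω : Set 𝔼} (hΩ : IsOpen Ω) {k : ℕ}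
    (huk : ContDiffOn ℝ (2 * k : ℕ) u Ω) {x : 𝔼} (hx : closedBall x ε ⊆ Ω) :
    Integrable fun y => negLaplacianPow k u y * ρ (x - y) :=
  integrable_mul_of_tsupport_subset hΩ
    (ContDiffOn.negLaplacianPow hΩ (j := 0) k huk (by simp)).continuousOn
    (hρ.contDiff_comp_sub x).continuous (hasCompactSupport_comp_sub hρ.hasCompactSupport x)
    ((hρ.tsupport_comp_sub_subset x).trans hx)

theorem integrable_comp_sub (hρ : IsMollifier ε ρ) (x : 𝔼) : Integrable fun y => ρ (x - y) :=
  (hρ.contDiff_comp_sub x).continuous.integrable_of_hasCompactSupport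
    (hasCompactSupport_comp_sub hρ.hasCompactSupport x)

theorem comp_sub_eq_zero (hρ : IsMollifier ε ρ) {x y : 𝔼} (hy : y ∉ closedBall x ε) :
    ρ (x - y) = 0 := by
  rw [mem_closedBall, not_le, dist_comm, dist_eq_norm] at hy
  exact hρ.eq_zero hy

theorem le_negLaplacianPow_mollify (hρ : IsMollifier ε ρ) (hu : Continuous u) {Ω : Set 𝔼}
    (hΩ : IsOpen Ω) {k : ℕ} (huk : ContDiffOn ℝ (2 * k : ℕ) u Ω) {x : 𝔼}
    (hx : closedBall x ε ⊆ Ω) {a : ℝ} (ha : ∀ y ∈ closedBall x ε, a ≤ negLaplacianPow k u y) :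
    a ≤ negLaplacianPow k (mollify ρ u) x := by
  rw [hρ.negLaplacianPow_mollify_eq hu hΩ huk hx]
  calc a = ∫ y, a * ρ (x - y) := by rw [integral_const_mul, hρ.integral_comp_sub, mul_one]
    _ ≤ _ := integral_mono ((hρ.integrable_comp_sub x).const_mul a)
      (hρ.integrable_negLaplacianPow_mul hΩ huk hx) fun y => by
        by_cases hy : y ∈ closedBall x ε
        · exact mul_le_mul_of_nonneg_right (ha y hy) (hρ.nonneg _)
        · simp [hρ.comp_sub_eq_zero hy]

theorem negLaplacianPow_mollify_le (hρ : IsMollifier ε ρ) (hu : Continuous u) {Ω : Set 𝔼}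
    (hΩ : IsOpen Ω) {k : ℕ} (huk : ContDiffOn ℝ (2 * k : ℕ) u Ω) {x : 𝔼}
    (hx : closedBall x ε ⊆ Ω) {a : ℝ} (ha : ∀ y ∈ closedBall x ε, negLaplacianPow k u y ≤ a) :
    negLaplacianPow k (mollify ρ u) x ≤ a := by
  rw [hρ.negLaplacianPow_mollify_eq hu hΩ huk hx]
  calc _ ≤ ∫ y, a * ρ (x - y) := integral_mono (hρ.integrable_negLaplacianPow_mul hΩ huk hx)
        ((hρ.integrable_comp_sub x).const_mul a) fun y => by
        by_cases hy : y ∈ closedBall x ε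
        · exact mul_le_mul_of_nonneg_right (ha y hy) (hρ.nonneg _)
        · simp [hρ.comp_sub_eq_zero hy]
    _ = a := by rw [integral_const_mul, hρ.integral_comp_sub, mul_one]

theorem mollify_nonneg (hρ : IsMollifier ε ρ) (hu : ∀ x, 0 ≤ u x) (x : 𝔼) :
    0 ≤ mollify ρ u x :=
  integral_nonneg fun y => mul_nonneg (hu y) (hρ.nonneg _)

/-- Values of the mollification on the ball of radius `R` about `a` see `u` only within distance
`‖a‖ + R + ε ≤ 2R` of the origin, and convolution with `ρ` preserves mass. The radius `3R` leaves
room to spare. -/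
theorem integral_unitBall_mollify_le (hρ : IsMollifier ε ρ) (hu : Continuous u)
    (hu0 : ∀ x, 0 ≤ u x) (a : 𝔼) {R : ℝ} (hR : 0 < R) (haR : ‖a‖ + ε ≤ R) :
    ∫ y in closedBall (0 : 𝔼) 1, mollify ρ u (a + R • y) ≤
      3 ^ n * ∫ y in closedBall (0 : 𝔼) 1, u ((3 * R) • y) := by
  -- The truncation is integrable, so the integral of its convolution with `ρ` factors.
  set w : 𝔼 → ℝ := (closedBall (0 : 𝔼) (3 * R)).indicator u with hw
  have hwi : Integrable w :=
    (hu.continuousOn.integrableOn_compact (isCompact_closedBall _ _)).integrable_indicator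
      measurableSet_closedBall
  have hw0 : ∀ x, 0 ≤ w x := fun x => indicator_nonneg (fun y _ => hu0 y) x
  have hρi : Integrable ρ :=
    hρ.contDiff.continuous.integrable_of_hasCompactSupport hρ.hasCompactSupport
  have hmi : Integrable (mollify ρ w) := by
    rw [mollify_eq_convolution]
    exact hwi.integrable_convolution _ hρi
  have hmi' : Integrable fun y : 𝔼 => mollify ρ w (a + R • y) :=
    (hmi.comp_add_left a).comp_smul hR.ne'
  have h1 : ∫ y in closedBall (0 : 𝔼) 1, mollify ρ u (a + R • y) ≤
      ∫ y, mollify ρ w (a + R • y) := by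
    rw [← integral_indicator measurableSet_closedBall]
    refine integral_mono_of_nonneg (Eventually.of_forall fun y => indicator_nonneg
      (fun z _ => hρ.mollify_nonneg hu0 _) y) hmi' (Eventually.of_forall fun y => ?_)
    by_cases hy : y ∈ closedBall (0 : 𝔼) 1
    · rw [indicator_of_mem hy]
      refine le_of_eq (integral_congr_ae (Eventually.of_forall fun z => ?_))
      by_cases hz : z ∈ closedBall (0 : 𝔼) (3 * R)
      · simp only [hw, indicator_of_mem hz]
      · simp only [hw, indicator_of_notMem hz]
        rw [hρ.comp_sub_eq_zero, mul_zero, mul_zero]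
        intro hz'
        apply hz
        rw [mem_closedBall_zero_iff] at hy ⊢
        rw [mem_closedBall, dist_eq_norm] at hz'
        have e1 : ‖z‖ ≤ ‖z - (a + R • y)‖ + ‖a + R • y‖ := by
          simpa using norm_add_le (z - (a + R • y)) (a + R • y)
        have e2 : ‖a + R • y‖ ≤ ‖a‖ + R * ‖y‖ := by
          refine (norm_add_le _ _).trans_eq ?_
          rw [norm_smul, Real.norm_of_nonneg hR.le]
        nlinarith
    · rw [indicator_of_notMem hy]
      exact hρ.mollify_nonneg hw0 _
  have h2 : ∫ y, mollify ρ w (a + R • y) = (R ^ n)⁻¹ * ∫ y, w y := by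
    rw [Measure.integral_comp_smul volume (fun z => mollify ρ w (a + z)),
      integral_add_left_eq_self (mollify ρ w) a, mollify_eq_convolution,
      integral_convolution _ hwi hρi, hρ.integral_eq_one]
    simp only [finrank_euclideanSpace, Fintype.card_fin, smul_eq_mul]
    rw [abs_of_pos (by positivity)]
    simp
  have h3 : ∫ y in closedBall (0 : 𝔼) 1, u ((3 * R) • y) = ((3 * R) ^ n)⁻¹ * ∫ y, w y := by
    rw [Measure.setIntegral_comp_smul_of_pos volume u _ (by positivity : 0 < 3 * R),
      smul_unitClosedBall, hw, integral_indicator measurableSet_closedBall,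
      Real.norm_of_nonneg (by positivity)]
    simp
  rw [h3]
  rw [h2] at h1
  refine h1.trans_eq ?_
  rw [mul_pow]
  field_simp

theorem tendsto_integral_unitBall_mollify (hρ : IsMollifier ε ρ) (hu : Continuous u)
    (hu0 : ∀ x, 0 ≤ u x)
    (hlim : Tendsto (fun R : ℝ => ∫ x in closedBall (0 : 𝔼) 1, u (R • x)) atTop (𝓝 0)) (a : 𝔼) :
    Tendsto (fun R : ℝ => ∫ y in closedBall (0 : 𝔼) 1, |mollify ρ u (a + R • y)|)
      atTop (𝓝 0) := by
  simp_rw [abs_of_nonneg (hρ.mollify_nonneg hu0 _)]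
  have h3 : Tendsto (fun R : ℝ => 3 ^ n * ∫ y in closedBall (0 : 𝔼) 1, u ((3 * R) • y))
      atTop (𝓝 0) := by
    simpa using (hlim.comp (tendsto_id.const_mul_atTop (by norm_num : (0 : ℝ) < 3))).const_mul
      ((3 : ℝ) ^ n)
  refine tendsto_of_tendsto_of_tendsto_of_le_of_le' tendsto_const_nhds h3
    (Eventually.of_forall fun R => integral_nonneg fun y => hρ.mollify_nonneg hu0 _) ?_
  filter_upwards [eventually_gt_atTop 0, eventually_ge_atTop (‖a‖ + ε)] with R hR haR
  exact hρ.integral_unitBall_mollify_le hu hu0 a hR haR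

end IsMollifier

end Mollification

/-! ### Signs of the iterated Laplacians and strict positivity -/

section Positivity

variable {n : ℕ}

local notation "𝔼" => EuclideanSpace ℝ (Fin n)

theorem exists_closedBall_subset_forall_le {g : 𝔼 → ℝ} {Ω : Set 𝔼} (hΩ : IsOpen Ω)
    (hg : ContinuousOn g Ω) {x : 𝔼} (hx : x ∈ Ω) {a : ℝ} (ha : g x < a) :
    ∃ ε > 0, closedBall x ε ⊆ Ω ∧ ∀ y ∈ closedBall x ε, g y ≤ a := by
  have h1 : ∀ᶠ y in 𝓝 x, g y < a :=
    (hg.continuousAt (hΩ.mem_nhds hx)).eventually (gt_mem_nhds ha)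
  obtain ⟨ε, hε, h⟩ := nhds_basis_closedBall.mem_iff.1 (inter_mem (hΩ.mem_nhds hx) h1)
  exact ⟨ε, hε, fun y hy => (h hy).1, fun y hy => (show g y < a from (h hy).2).le⟩

namespace IsPuncturedSolution

variable {m : ℕ} {σ p : ℝ} {u : EuclideanSpace ℝ (Fin n) → ℝ}

theorem negLaplacianPow_mollify_nonneg (hn : 2 * m < n) (hσ : -(2 * (m : ℝ)) < σ)
    (hp : 1 < p) (hσp : -(n : ℝ) < -σ / (p - 1)) (hu : IsPuncturedSolution m σ p u) {ε : ℝ}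
    {ρ : 𝔼 → ℝ} (hρ : IsMollifier ε ρ) {k : ℕ} (hk : k ≤ m) (x : 𝔼) :
    0 ≤ negLaplacianPow k (mollify ρ u) x := by
  refine negLaplacianPow_nonneg_of_averages_tendsto
    (contDiff_mollify hu.continuous hρ.contDiff hρ.hasCompactSupport) (fun x => ?_)
    (hρ.tendsto_integral_unitBall_mollify hu.continuous hu.nonneg
      (hu.tendsto_integral_unitBall_dilation hn hσ hp hσp)) k hk x
  rw [negLaplacianPow_mollify_apply hu.continuous hρ.contDiff hρ.hasCompactSupport,
    hu.integral_mul_negLaplacianPow hn hσ hp (hρ.contDiff_comp_sub x)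
      (hasCompactSupport_comp_sub hρ.hasCompactSupport x)]
  exact integral_nonneg fun y => mul_nonneg (mul_nonneg (Real.rpow_nonneg (norm_nonneg _) _)
    (Real.rpow_nonneg (hu.nonneg y) _)) (hρ.nonneg _)

theorem contDiffOn_of_le (hu : IsPuncturedSolution m σ p u) {k : ℕ} (hk : k ≤ m) :
    ContDiffOn ℝ (2 * k : ℕ) u {0}ᶜ :=
  hu.contDiffOn.of_le (by exact_mod_cast (by omega : 2 * k ≤ 2 * m))

/-- A negative value would persist on a small ball by continuity, and a mollifier at that scale
would have a negative iterated Laplacian at the centre. -/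
theorem negLaplacianPow_nonneg (hn : 2 * m < n) (hσ : -(2 * (m : ℝ)) < σ)
    (hp : 1 < p) (hσp : -(n : ℝ) < -σ / (p - 1)) (hu : IsPuncturedSolution m σ p u) {k : ℕ}
    (hk : k ≤ m) {x : 𝔼} (hx : x ≠ 0) : 0 ≤ negLaplacianPow k u x := by
  by_contra! h
  obtain ⟨a, ha, ha0⟩ := exists_between h
  have huk := hu.contDiffOn_of_le hk
  obtain ⟨ε, hε, hεΩ, hεa⟩ := exists_closedBall_subset_forall_le isOpen_compl_singleton
    (ContDiffOn.negLaplacianPow isOpen_compl_singleton (j := 0) k huk (by simp)).continuousOn hx ha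
  obtain ⟨ρ, hρ⟩ := exists_isMollifier (n := n) hε
  have h1 := hρ.negLaplacianPow_mollify_le hu.continuous isOpen_compl_singleton huk hεΩ hεa
  have h2 := hu.negLaplacianPow_mollify_nonneg hn hσ hp hσp hρ hk x
  linarith

theorem exists_negLaplacianPow_pos (hn : 2 * m < n) (hσ : -(2 * (m : ℝ)) < σ)
    (hp : 1 < p) (hσp : -(n : ℝ) < -σ / (p - 1)) (hu : IsPuncturedSolution m σ p u)
    (hne : ∃ x, u x ≠ 0) {k : ℕ} (hk : k ≤ m) : ∃ x ≠ 0, 0 < negLaplacianPow k u x := by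
  by_contra! h
  have : NeZero n := ⟨by omega⟩
  have : Nontrivial 𝔼 := inferInstance
  have hzero : ∀ x : 𝔼, x ≠ 0 → negLaplacianPow k u x = 0 := fun x hx =>
    le_antisymm (h x hx) (hu.negLaplacianPow_nonneg hn hσ hp hσp hk hx)
  have hu0 : ∀ x : 𝔼, x ≠ 0 → u x = 0 := by
    intro x hx
    have hev : negLaplacianPow k u =ᶠ[𝓝 x] 0 := by
      filter_upwards [isOpen_compl_singleton.mem_nhds hx] with y hy
      exact hzero y hy
    -- If `(-Δ)^k u` vanishes near `x`, so does `(-Δ)^m u`, and the equation gives `u x = 0`.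
    have h1 : negLaplacianPow m u = negLaplacianPow (m - k) (negLaplacianPow k u) := by
      simp only [negLaplacianPow]
      rw [← Function.iterate_add_apply, Nat.sub_add_cancel hk]
    have h2 : negLaplacianPow m u x = 0 := by
      rw [h1, (negLaplacianPow_congr hev (m - k)).eq_of_nhds, negLaplacianPow_zero_fun]
      rfl
    rw [hu.equation x hx, mul_eq_zero] at h2
    rcases h2 with h2 | h2
    · exact absurd h2 (Real.rpow_pos_of_pos (norm_pos_iff.2 hx) _).ne'
    · exact (Real.rpow_eq_zero (hu.nonneg x) (by linarith)).1 h2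
  have hu00 : u = 0 := Continuous.ext_on (dense_compl_singleton (0 : 𝔼)) hu.continuous
    continuous_zero hu0
  obtain ⟨x, hx⟩ := hne
  exact hx (congrFun hu00 x)

/-- `k < m` is needed so that `(-Δ)^(k+1)` has a sign too, i.e. `(-Δ)^k` of the mollification is
superharmonic. The set `Ω` is left free so that `k = 0` can include the origin, where `u` is only
known to be continuous. -/
theorem negLaplacianPow_pos (hn : 2 * m < n) (hσ : -(2 * (m : ℝ)) < σ)
    (hp : 1 < p) (hσp : -(n : ℝ) < -σ / (p - 1)) (hu : IsPuncturedSolution m σ p u)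
    (hne : ∃ x, u x ≠ 0) {k : ℕ} (hk : k < m) {Ω : Set 𝔼} (hΩ : IsOpen Ω)
    (huk : ContDiffOn ℝ (2 * k : ℕ) u Ω) {x₀ : 𝔼} (hx₀ : x₀ ∈ Ω) :
    0 < negLaplacianPow k u x₀ := by
  obtain ⟨x₁, hx₁, hpos⟩ := hu.exists_negLaplacianPow_pos hn hσ hp hσp hne hk.le
  have huk' := hu.contDiffOn_of_le hk.le
  obtain ⟨c, hc0, hc⟩ := exists_between hpos
  obtain ⟨r, hr, hrΩ, hrc⟩ := exists_closedBall_subset_forall_le isOpen_compl_singleton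
    (ContDiffOn.negLaplacianPow isOpen_compl_singleton (j := 0) k huk' (by simp)).continuousOn.neg
    hx₁ (neg_lt_neg hc)
  -- `c * b` is a lower barrier for `(-Δ)^k` of every mollification at scale at most `r / 2`: the
  -- mollifier then sees only the ball of radius `r`, where `(-Δ)^k u ≥ c`.
  let b : ContDiffBump x₁ := ⟨r / 4, r / 2, by positivity, by linarith⟩
  -- With this radius `x₁` lies in the open ball about `x₀` on which the rescaled kernel is
  -- positive.
  set R : ℝ := ‖x₁ - x₀‖ + 1 with hR
  have hR0 : 0 < R := by positivity
  have hcont : Continuous fun y : 𝔼 => c * b (x₀ + R • y) * radialKernel y :=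
    (continuous_const.mul (b.continuous.comp (by fun_prop))).mul
      contDiff_radialKernel.continuous
  have hcs : HasCompactSupport fun y : 𝔼 => c * b (x₀ + R • y) * radialKernel y :=
    hasCompactSupport_radialKernel.mul_left
  have hJ : 0 < ∫ y : 𝔼, c * b (x₀ + R • y) * radialKernel y := by
    refine hcont.integral_pos_of_hasCompactSupport_nonneg_nonzero hcs
      (fun y => mul_nonneg (mul_nonneg hc0.le b.nonneg) (radialKernel_nonneg y))
      (x := R⁻¹ • (x₁ - x₀)) ?_
    have e1 : x₀ + R • (R⁻¹ • (x₁ - x₀)) = x₁ := by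
      rw [smul_inv_smul₀ hR0.ne', add_sub_cancel]
    have e2 : 0 < radialKernel (R⁻¹ • (x₁ - x₀)) := by
      refine radialKernel_pos ?_
      rw [norm_smul, norm_inv, Real.norm_of_nonneg hR0.le, inv_mul_lt_iff₀ hR0]
      linarith
    rw [e1, b.one_of_mem_closedBall (mem_closedBall_self b.rIn_pos.le), mul_one]
    exact (mul_pos hc0 e2).ne'
  set J := ∫ y : 𝔼, c * b (x₀ + R • y) * radialKernel y
  have hκ := integral_radialKernel_pos (n := n)
  set κ := ∫ y : 𝔼, radialKernel y
  by_contra! hcon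
  -- `J` does not depend on the mollifier. The mean value inequality will give `J ≤ J / (2 * κ) * κ
  -- = J / 2`, a contradiction.
  have hlt : negLaplacianPow k u x₀ < J / (2 * κ) := hcon.trans_lt (by positivity)
  obtain ⟨ε₀, hε₀, hε₀Ω, hε₀a⟩ := exists_closedBall_subset_forall_le hΩ
    (ContDiffOn.negLaplacianPow hΩ (j := 0) k huk (by simp)).continuousOn hx₀ hlt
  have hε : 0 < min ε₀ (r / 2) := by positivity
  obtain ⟨ρ, hρ⟩ := exists_isMollifier (n := n) hε
  have hsub : closedBall x₀ (min ε₀ (r / 2)) ⊆ closedBall x₀ ε₀ :=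
    closedBall_subset_closedBall (min_le_left _ _)
  have hv : ContDiff ℝ ∞ (negLaplacianPow k (mollify ρ u)) :=
    (contDiff_mollify hu.continuous hρ.contDiff hρ.hasCompactSupport).negLaplacianPow k
  have hup := hρ.negLaplacianPow_mollify_le hu.continuous hΩ huk (hsub.trans hε₀Ω)
    fun y hy => hε₀a y (hsub hy)
  have hmv := integral_comp_affine_mul_radialKernel_le (hv.of_le (by norm_cast)) (fun x => by
    have := hu.negLaplacianPow_mollify_nonneg hn hσ hp hσp hρ (k := k + 1) hk x
    rw [negLaplacianPow_succ, Pi.neg_apply] at this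
    linarith) x₀ hR0.le
  have hlow : J ≤ ∫ y, negLaplacianPow k (mollify ρ u) (x₀ + R • y) * radialKernel y := by
    refine integral_mono (hcont.integrable_of_hasCompactSupport hcs)
      (((hv.continuous.comp (by fun_prop)).mul
        contDiff_radialKernel.continuous).integrable_of_hasCompactSupport
        hasCompactSupport_radialKernel.mul_left) fun y => ?_
    refine mul_le_mul_of_nonneg_right ?_ (radialKernel_nonneg y)
    by_cases hy : x₀ + R • y ∈ ball x₁ (r / 2)
    · have hsub' : closedBall (x₀ + R • y) (min ε₀ (r / 2)) ⊆ closedBall x₁ r := by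
        refine closedBall_subset_closedBall' ?_
        have := min_le_right ε₀ (r / 2)
        rw [mem_ball] at hy
        linarith
      refine (mul_le_of_le_one_right hc0.le b.le_one).trans ?_
      exact hρ.le_negLaplacianPow_mollify hu.continuous isOpen_compl_singleton huk'
        (hsub'.trans hrΩ) fun z hz => neg_le_neg_iff.1 (hrc z (hsub' hz))
    · rw [b.zero_of_le_dist (not_lt.1 hy), mul_zero]
      exact hu.negLaplacianPow_mollify_nonneg hn hσ hp hσp hρ hk.le _
  have h1 : J ≤ J / (2 * κ) * κ := (hlow.trans hmv).trans (mul_le_mul_of_nonneg_right hup hκ.le)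
  have h2 : J / (2 * κ) * κ = J / 2 := by field_simp
  linarith

end IsPuncturedSolution

end Positivity

theorem mainTheorem6 (n m : ℕ) (hm : 1 ≤ m) (hn : 2 * m < n) (σ p : ℝ)
    (hσ : -(2 * (m : ℝ)) < σ)
    (hp : ((n : ℝ) + 2 * (m : ℝ) + 2 * σ) / ((n : ℝ) - 2 * (m : ℝ)) ≤ p)
    (u : EuclideanSpace ℝ (Fin n) → ℝ) (hu : IsClassicalSolution m σ p u) :
    (∀ i : ℕ, 1 ≤ i → i ≤ m - 1 → ∀ x : EuclideanSpace ℝ (Fin n), x ≠ 0 →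
      0 < negLaplacianPow (m - i) u x) ∧
    (∀ x : EuclideanSpace ℝ (Fin n), 0 < u x) := by
  have hm' : (1 : ℝ) ≤ m := by exact_mod_cast hm
  have hn' : 0 < (n : ℝ) - 2 * (m : ℝ) := by
    have : 2 * (m : ℝ) < n := by exact_mod_cast hn
    linarith
  rw [div_le_iff₀ hn'] at hp
  have hp1 : 1 < p := by
    by_contra! h
    nlinarith
  have hσp : -(n : ℝ) < -σ / (p - 1) := by
    rw [lt_div_iff₀ (by linarith)]
    -- `hp` gives `(p - 1)(n - 2m) ≥ 4m + 2σ`, and `n(4m + 2σ) - σ(n - 2m) = 4mn + σ(n + 2m) > 2m(n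
    -- - 2m) > 0` as `σ > -2m`.
    have h1 : σ * (n - 2 * m) < n * (p - 1) * (n - 2 * m) := by nlinarith
    have := lt_of_mul_lt_mul_right h1 hn'.le
    linarith
  have hu' := hu.isPuncturedSolution
  refine ⟨fun i hi him x hx => ?_, fun x => ?_⟩
  · exact hu'.negLaplacianPow_pos hn hσ hp1 hσp hu.nontrivial (by omega) isOpen_compl_singleton
      (hu'.contDiffOn_of_le (by omega)) hx
  -- For `k = 0` the required regularity is mere continuity, so the whole space is allowed and the
  -- origin is covered.
  · exact hu'.negLaplacianPow_pos hn hσ hp1 hσp hu.nontrivial (k := 0) (by omega) isOpen_univ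
      (by simpa using hu'.continuous) (mem_univ x)
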